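/- Let $d\ge 1$, $\alpha\in[-1/2,\infty)^d$, $\varepsilon\in\{0,1\}^d$, $|\alpha|=\alpha_1+\dots+\alpha_d$, and let $dw_\alpha^+(x)=\prod_{j=1}^d x_j^{2\alpha_j+1}\,dx$ on $(0,\infty)^d$, with $\langle F,g\rangle_{dw_\alpha^+}=\int_{(0,\infty)^d}F\,\overline{g}\,dw_\alpha^+$. For $k\in\mathbb N^d$ let $h_k^\alpha(x)=\prod_{i=1}^d h_{k_i}^{\alpha_i}(x_i)$ be the generalized Hermite functions, where, with $L_n^{a}$ the Laguerre polynomials, $$h_{2n}^{a}(s)=(-1)^n\Big(\frac{n!}{\Gamma(n+a+1)}\Big)^{1/2}e^{-s^2/2}L_n^{a}(s^2),\qquad h_{2n+1}^{a}(s)=(-1)^n\Big(\frac{n!}{\Gamma(n+a+2)}\Big)^{1/2}e^{-s^2/2}\,s\,L_n^{a+1}(s^2).$$ Put $\lambda_n^\alpha=2n+2|\alpha|+2d$. For $m:[\lambda_0^\alpha,\infty)\to\mathbb C$ and $f\in L^2((0,\infty)^d,dw_\alpha^+)$ let $$m^{\varepsilon,+}(\mathcal L_\alpha)f=\sum_{n=0}^\infty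 m(\lambda_n^\alpha)\sum_{\substack{|k|=n\\ k_i\equiv\varepsilon_i\ (\mathrm{mod}\ 2)\ \forall i}}\langle f,h_k^\alpha\rangle_{dw_\alpha^+}\,h_k^\alpha ,$$ and for $t>0$, $x,y\in(0,\infty)^d$ let $$G_t^{\alpha,\varepsilon}(x,y)=(2\sinh 2t)^{-d}\exp\Big(-\tfrac12\coth(2t)\,(|x|^2+|y|^2)\Big)\prod_{i=1}^d (x_iy_i)^{\varepsilon_i}\,\frac{I_{\alpha_i+\varepsilon_i}\big(\frac{x_iy_i}{\sinh 2t}\big)}{(x_iy_i)^{\alpha_i+\varepsilon_i}},$$ where $I_\nu$ is the modified Bessel function of the first kind of order $\nu$. (a) Let $\eta:(0,\infty)\to\mathbb C$ be bounded and measurable, $m(z)=m_\eta(z)=z\int_0^\infty e^{-tz}\eta(t)\,dt$, and $$K(x,y)=K_\eta^{\alpha,\varepsilon}(x,y)=-\int_0^\infty \partial_tG_t^{\alpha,\varepsilon}(x,y)\,\eta(t)\,dt .$$ (b) Let $\mu$ be a signed or complex Borel measure on $(0,\infty)$ (possibly of infinite total variation) whose total variation measure satisfies $\int_0^\infty e^{-t\lambda_0^\alpha}\,d|\mu|(t)<\infty$,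 $m(z)=m_\mu(z)=\int_0^\infty e^{-tz}\,d\mu(t)$, and $$K(x,y)=\mathcal K_\mu^{\alpha,\varepsilon}(x,y)=\int_0^\infty G_t^{\alpha,\varepsilon}(x,y)\,d\mu(t).$$ In each of the cases (a) and (b), the series defining $m^{\varepsilon,+}(\mathcal L_\alpha)f$ converges unconditionally (over $n$) in $L^2((0,\infty)^d,dw_\alpha^+)$ for every $f$ in this space, the integral defining $K(x,y)$ converges absolutely for all $x\neq y$ in $(0,\infty)^d$, and $m^{\varepsilon,+}(\mathcal L_\alpha)$ is associated with the kernel $K$ in the sense that for all $f,g\in C_c^\infty((0,\infty)^d)$ with disjoint supports $$\langle m^{\varepsilon,+}(\mathcal L_\alpha)f,g\rangle_{dw_\alpha^+}=\int_{(0,\infty)^d}\int_{(0,\infty)^d}K(x,y)\,f(y)\,dw_\alpha^+(y)\,\overline{g(x)}\,dw_\alpha^+(x),$$ where the double integral converges absolutely. -/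

import Mathlib

open MeasureTheory Set

noncomputable section

namespace Dunkl

/-! The generalized Hermite functions. -/

/-- The Laguerre polynomial of degree `n` and order `a` (for `a > -1`),
`L_n^a(x) = ∑_{j ≤ n} (-1)^j Γ(n+a+1) / (Γ(j+a+1) (n-j)! j!) x^j`. -/
def laguerre (a : ℝ) (n : ℕ) (x : ℝ) : ℝ :=
  ∑ j ∈ Finset.range (n + 1),
    (-1) ^ j * Real.Gamma (n + a + 1) /
      (Real.Gamma (j + a + 1) * (n - j).factorial * j.factorial) * x ^ j

/-- The one-dimensional generalized Hermite function of degree `n` and order `a`. The constants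
normalize it in `L²(ℝ, |x|^{2a+1} dx)`. -/
def hermite₁ (a : ℝ) (n : ℕ) (x : ℝ) : ℝ :=
  if n % 2 = 0 then
    (-1) ^ (n / 2) * √((n / 2).factorial / Real.Gamma ((n / 2 : ℕ) + a + 1)) *
      Real.exp (-x ^ 2 / 2) * laguerre a (n / 2) (x ^ 2)
  else
    (-1) ^ (n / 2) * √((n / 2).factorial / Real.Gamma ((n / 2 : ℕ) + a + 2)) *
      Real.exp (-x ^ 2 / 2) * x * laguerre (a + 1) (n / 2) (x ^ 2)

/-- The generalized Hermite function `h_k^α` on `ℝ^d`. -/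
def hermite {d : ℕ} (α : Fin d → ℝ) (k : Fin d → ℕ) (x : Fin d → ℝ) : ℝ :=
  ∏ i, hermite₁ (α i) (k i) (x i)

/-- The eigenvalues `λ_n^α = 2n + 2|α| + 2d`. -/
def eigenvalue {d : ℕ} (α : Fin d → ℝ) (n : ℕ) : ℝ := 2 * n + 2 * ∑ i, α i + 2 * d

/-- The multi-indices `k` of length `n` whose parities are prescribed by `ε`. -/
def shell {d : ℕ} (ε : Fin d → Fin 2) (n : ℕ) : Finset (Fin d → ℕ) :=
  {k ∈ Finset.piAntidiag Finset.univ n | ∀ i, k i % 2 = (ε i : ℕ)}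

/-! The space `L²((0,∞)^d, dw_α^+)`. Points of `ℝ^d` are elements of `Fin d → ℝ`; the squared
Euclidean norm is written out as a sum of squares wherever it occurs. -/

/-- The open orthant `(0,∞)^d`. -/
def orthant (d : ℕ) : TopologicalSpace.Opens (Fin d → ℝ) :=
  ⟨univ.pi fun _ => Ioi 0, isOpen_set_pi finite_univ fun _ _ => isOpen_Ioi⟩

/-- The measure `w_α^+` with density `∏_j |x_j|^{2α_j+1}` on `(0,∞)^d`. -/
def wPlus {d : ℕ} (α : Fin d → ℝ) : Measure (Fin d → ℝ) :=
  (volume.restrict (orthant d : Set (Fin d → ℝ))).withDensity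
    fun x => ENNReal.ofReal (∏ i, |x i| ^ (2 * α i + 1))

/-- The complex Hilbert space `L²((0,∞)^d, dw_α^+)`. -/
abbrev L2Plus {d : ℕ} (α : Fin d → ℝ) : Type := Lp ℂ 2 (wPlus α)

lemma hermite₁_eq (a : ℝ) (n : ℕ) :
    ∃ p : Polynomial ℝ, ∀ x, hermite₁ a n x = p.eval x * Real.exp (-x ^ 2 / 2) := by
  have key : ∀ (b : ℝ) (m : ℕ), ∃ p : Polynomial ℝ, ∀ x, laguerre b m (x ^ 2) = p.eval x := by
    intro b m
    refine ⟨∑ j ∈ Finset.range (m + 1),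
      Polynomial.C ((-1) ^ j * Real.Gamma (m + b + 1) /
        (Real.Gamma (j + b + 1) * (m - j).factorial * j.factorial)) *
          (Polynomial.X ^ 2) ^ j, fun x => ?_⟩
    simp [laguerre, Polynomial.eval_finsetSum]
  unfold hermite₁
  split_ifs
  · obtain ⟨p, hp⟩ := key a (n / 2)
    refine ⟨Polynomial.C ((-1) ^ (n / 2) *
      √((n / 2).factorial / Real.Gamma ((n / 2 : ℕ) + a + 1))) * p, fun x => ?_⟩
    rw [hp, Polynomial.eval_mul, Polynomial.eval_C]
    ring
  · obtain ⟨p, hp⟩ := key (a + 1) (n / 2)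
    refine ⟨Polynomial.C ((-1) ^ (n / 2) *
      √((n / 2).factorial / Real.Gamma ((n / 2 : ℕ) + a + 2))) * Polynomial.X * p, fun x => ?_⟩
    rw [hp, Polynomial.eval_mul, Polynomial.eval_mul, Polynomial.eval_C, Polynomial.eval_X]
    ring

lemma integrable_hermite₁_sq (a : ℝ) (ha : -1 / 2 ≤ a) (n : ℕ) :
    Integrable (fun x : ℝ => hermite₁ a n x ^ 2 * |x| ^ (2 * a + 1))
      (volume.restrict (Ioi 0)) := by
  obtain ⟨p, hp⟩ := hermite₁_eq a n
  have h : Integrable (fun x : ℝ => ∑ j ∈ Finset.range ((p ^ 2).natDegree + 1),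
      (p ^ 2).coeff j * (x ^ ((j : ℝ) + (2 * a + 1)) * Real.exp (-1 * x ^ 2)))
      (volume.restrict (Ioi 0)) := by
    refine (integrable_finsetSum _ fun j _ => ?_).mono_measure Measure.restrict_le_self
    refine (integrable_rpow_mul_exp_neg_mul_sq one_pos ?_).const_mul _
    have : (0 : ℝ) ≤ j := j.cast_nonneg
    linarith
  refine h.congr ?_
  filter_upwards [ae_restrict_mem measurableSet_Ioi] with x hx
  have hx : (0 : ℝ) < x := hx
  have e : Real.exp (-1 * x ^ 2) = Real.exp (-x ^ 2 / 2) ^ 2 := by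
    rw [← Real.exp_nat_mul]
    congr 1
    push_cast
    ring
  have q : p.eval x ^ 2 =
      ∑ j ∈ Finset.range ((p ^ 2).natDegree + 1), (p ^ 2).coeff j * x ^ j := by
    rw [← Polynomial.eval_eq_sum_range, Polynomial.eval_pow]
  rw [hp, mul_pow, q, abs_of_pos hx, Finset.sum_mul, Finset.sum_mul]
  refine Finset.sum_congr rfl fun j _ => ?_
  rw [e, Real.rpow_add hx, Real.rpow_natCast]
  ring

lemma continuous_hermite {d : ℕ} (α : Fin d → ℝ) (k : Fin d → ℕ) : Continuous (hermite α k) := by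
  refine continuous_finsetProd _ fun i _ => ?_
  obtain ⟨p, hp⟩ := hermite₁_eq (α i) (k i)
  simp only [hp]
  have := p.continuous
  fun_prop

lemma memLp_hermite {d : ℕ} (α : Fin d → ℝ) (hα : ∀ i, -1 / 2 ≤ α i) (k : Fin d → ℕ) :
    MemLp (fun x => (hermite α k x : ℂ)) 2 (wPlus α) := by
  have hc := continuous_hermite α k
  rw [memLp_two_iff_integrable_sq_norm (by fun_prop), wPlus, integrable_withDensity_iff
    (by fun_prop) (by simp)]
  have h : (volume.restrict (orthant d : Set (Fin d → ℝ))) =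
      Measure.pi fun _ : Fin d => (volume : Measure ℝ).restrict (Ioi 0) := by
    rw [volume_pi]
    exact Measure.restrict_pi_pi _ _
  rw [h]
  refine (Integrable.fintype_prod fun i => integrable_hermite₁_sq (α i) (hα i) (k i)).congr ?_
  refine Filter.Eventually.of_forall fun x => ?_
  simp only [Complex.norm_real, hermite, Real.norm_eq_abs, sq_abs]
  rw [ENNReal.toReal_ofReal (Finset.prod_nonneg fun i _ => by positivity),
    Finset.prod_mul_distrib, Finset.prod_pow]

lemma memLp_testFunction {d : ℕ} (α : Fin d → ℝ) (hα : ∀ i, -1 / 2 ≤ α i)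
    (f : TestFunction (orthant d) ℂ ⊤) : MemLp f 2 (wPlus α) := by
  have hw : Continuous fun x : Fin d → ℝ => ∏ i, |x i| ^ (2 * α i + 1) := by
    refine continuous_finsetProd _ fun i _ => ?_
    refine Continuous.rpow_const (by fun_prop) fun x => Or.inr ?_
    linarith [hα i]
  have : IsLocallyFiniteMeasure (wPlus α) := IsLocallyFiniteMeasure.withDensity_ofReal hw
  exact f.continuous.memLp_of_hasCompactSupport f.hasCompactSupport

/-- `h_k^α` as an element of `L²((0,∞)^d, dw_α^+)`. -/
def hermiteL2 {d : ℕ} (α : Fin d → ℝ) (hα : ∀ i, -1 / 2 ≤ α i) (k : Fin d → ℕ) : L2Plus α :=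
  (memLp_hermite α hα k).toLp

/-- The `n`th term of the series defining the Laguerre-type operator. Mathlib's inner product is
conjugate linear in its first argument, so that `inner ℂ h u` is the integral of `u` times the
conjugate of `h`. -/
def multiplierTerm {d : ℕ} (α : Fin d → ℝ) (hα : ∀ i, -1 / 2 ≤ α i) (ε : Fin d → Fin 2)
    (m : ℝ → ℂ) (u : L2Plus α) (n : ℕ) : L2Plus α :=
  m (eigenvalue α n) • ∑ k ∈ shell ε n, inner ℂ (hermiteL2 α hα k) u • hermiteL2 α hα k

/-- The Laguerre-type multiplier operator `m^{ε,+}(𝓛_α)` on `L²((0,∞)^d, dw_α^+)`. -/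
def multiplierOp {d : ℕ} (α : Fin d → ℝ) (hα : ∀ i, -1 / 2 ≤ α i) (ε : Fin d → Fin 2)
    (m : ℝ → ℂ) (u : L2Plus α) : L2Plus α :=
  ∑' n, multiplierTerm α hα ε m u n

/-! The component heat kernels. -/

/-- The modified Bessel function of the first kind and order `ν`, for `z > 0`. -/
def besselI (ν z : ℝ) : ℝ :=
  ∑' j : ℕ, (z / 2) ^ (2 * (j : ℝ) + ν) / (j.factorial * Real.Gamma (j + ν + 1))

/-- The component `G_t^{α,ε}(x,y)` of the Dunkl heat kernel, for `t > 0` and `x, y ∈ (0,∞)^d`. -/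
def heatKernel {d : ℕ} (α : Fin d → ℝ) (ε : Fin d → Fin 2) (t : ℝ) (x y : Fin d → ℝ) : ℝ :=
  ((2 * Real.sinh (2 * t)) ^ d)⁻¹ *
    Real.exp (-(1 / 2) * (Real.cosh (2 * t) / Real.sinh (2 * t)) *
      (∑ i, x i ^ 2 + ∑ i, y i ^ 2)) *
    ∏ i, (x i * y i) ^ (ε i : ℕ) *
      (besselI (α i + (ε i : ℕ)) (x i * y i / Real.sinh (2 * t)) /
        (x i * y i) ^ (α i + (ε i : ℕ)))

/-! Multipliers of Laplace type. -/

/-- `m_η(z) = z ∫_0^∞ e^{-tz} η(t) dt`. -/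
def laplaceMultiplier (η : ℝ → ℂ) (z : ℝ) : ℂ :=
  z * ∫ t in Ioi (0 : ℝ), (Real.exp (-t * z) : ℂ) * η t

/-- `K_η^{α,ε}(x,y) = -∫_0^∞ ∂_t G_t^{α,ε}(x,y) η(t) dt`. -/
def laplaceKernel {d : ℕ} (α : Fin d → ℝ) (ε : Fin d → Fin 2) (η : ℝ → ℂ)
    (x y : Fin d → ℝ) : ℂ :=
  -∫ t in Ioi (0 : ℝ), ((deriv (fun s => heatKernel α ε s x y) t : ℝ) : ℂ) * η t

/-! Multipliers of Laplace–Stieltjes type. -/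

/-- A signed or complex Borel measure `μ` on `(0,∞)`, possibly of infinite total variation, given
as `dμ = phase d|μ|` by its total variation measure `|μ|` and a measurable function of modulus
one (real-valued, that is `±1`, if `μ` is signed). Only the restriction to `(0,∞)` of either
component is ever used. -/
structure PolarMeasure where
  variation : Measure ℝ
  phase : ℝ → ℂ
  measurable_phase : Measurable phase
  norm_phase : ∀ t, 0 < t → ‖phase t‖ = 1

/-- `∫_0^∞ φ(t) dμ(t)`. -/
def PolarMeasure.integral (μ : PolarMeasure) (φ : ℝ → ℂ) : ℂ :=
  ∫ t in Ioi (0 : ℝ), φ t * μ.phase t ∂μ.variation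

/-- `m_μ(z) = ∫_0^∞ e^{-tz} dμ(t)`. -/
def stieltjesMultiplier (μ : PolarMeasure) (z : ℝ) : ℂ :=
  μ.integral fun t => (Real.exp (-t * z) : ℂ)

/-- `𝒦_μ^{α,ε}(x,y) = ∫_0^∞ G_t^{α,ε}(x,y) dμ(t)`. -/
def stieltjesKernel {d : ℕ} (α : Fin d → ℝ) (ε : Fin d → Fin 2) (μ : PolarMeasure)
    (x y : Fin d → ℝ) : ℂ :=
  μ.integral fun t => (heatKernel α ε t x y : ℂ)

/-- The operator `T` on `L²((0,∞)^d, dw_α^+)` is associated with the kernel `K`: for all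
`f, g ∈ C_c^∞((0,∞)^d)` with disjoint supports, the double integral of `K(x,y) f(y)` times the
conjugate of `g(x)` converges absolutely, and its value (as an iterated integral) is the inner
product of `T f` and `g`. -/
def IsAssociatedWith {d : ℕ} (α : Fin d → ℝ) (hα : ∀ i, -1 / 2 ≤ α i)
    (T : L2Plus α → L2Plus α) (K : (Fin d → ℝ) → (Fin d → ℝ) → ℂ) : Prop :=
  ∀ f g : TestFunction (orthant d) ℂ ⊤, Disjoint (tsupport f) (tsupport g) →
    Integrable (fun p : (Fin d → ℝ) × (Fin d → ℝ) =>
      K p.1 p.2 * f p.2 * (starRingEnd ℂ) (g p.1)) ((wPlus α).prod (wPlus α)) ∧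
    ∫ x, (T (memLp_testFunction α hα f).toLp : (Fin d → ℝ) → ℂ) x *
        (starRingEnd ℂ) (g x) ∂(wPlus α) =
      ∫ x, (∫ y, K x y * f y ∂(wPlus α)) * (starRingEnd ℂ) (g x) ∂(wPlus α)

end Dunkl

end

/-!
Mehler's formula exhibits the component `G_t` of the Dunkl heat kernel as the integral kernel of
`e^{-t𝓛_α}` on the span of the generalized Hermite functions of parity `ε`: for all points `x`, `y`
of the orthant, `∑_k e^{-tλ_{|k|}} h_k(x) h_k(y) = G_t(x, y)`, the sum over all `k` of parity `ε`
(`hasSum_heatKernel`). The multiplier `m_μ` is the superposition of the exponentials `e^{-tλ}`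
against `dμ(t)`, and `m_η` that of `λ e^{-tλ} = -∂_t e^{-tλ}` against `η(t) dt`. The kernels are
therefore the corresponding superpositions of `G_t` and `-∂_t G_t`, once all interchanges of sums
and integrals are justified (`isAssociatedWith_of_integral`).

In one variable Mehler's formula is the Hille–Hardy formula for Laguerre polynomials
(`hasSum_hilleHardy`). It is obtained by expanding both sides in powers of `x` and `y`, which
converges absolutely, and comparing coefficients by means of the closed form of
`∑_n Γ(n+c)/n! C(n,i) C(n,k) r^n` (`chooseSeries_eq`).

Unconditional convergence of the series in `L²` comes from the orthogonality of the `h_k` of a given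
parity (`orthonormal_hermiteL2`), Bessel's inequality, and the boundedness of `m` on the
eigenvalues. By the same inequality the coefficients `⟨f, h_k⟩⟨h_k, g⟩` are absolutely summable,
which handles the interchange of the sum over `k` with the integral over `t`.

The interchange of the integrals over `t` and over `(x, y)` rests on the fact that, when `f` and `g`
have disjoint supports, `G_t` and `∂_t G_t` are bounded on the product of the supports by a multiple
of `e^{-λ_0 t}`, for all `t > 0` (`heatKernel_bounds`). With `v = 1 / sinh 2t`, the bound
`z^{-ν} I_ν(z) ≲ e^z` for `ν ≥ -1/2` gives the factor `e^{-|x-y|² v / 2}`, which absorbs all powers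
of `v` as `t → 0`, while a factor `v^{λ_0/2}` supplies the decay as `t → ∞`.
-/

namespace Dunkl

lemma hasSum_of_eq {ι E : Type*} [AddCommMonoid E] [TopologicalSpace E] {f g : ι → E} {a b : E}
    (h : HasSum g b) (hf : ∀ n, f n = g n) (ha : a = b) : HasSum f a := by
  rw [funext hf, ha]
  exact h

/-! ### Power series with Gamma-function coefficients -/

lemma Gamma_natCast_add_pos {c : ℝ} (hc : 0 < c) (n : ℕ) : 0 < Real.Gamma (n + c) :=
  Real.Gamma_pos_of_pos (by positivity)

lemma Gamma_natCast_succ_add {c : ℝ} (hc : 0 < c) (n : ℕ) :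
    Real.Gamma ((n + 1 : ℕ) + c) = (n + c) * Real.Gamma (n + c) := by
  rw [← Real.Gamma_add_one (by positivity)]
  congr 1
  push_cast
  ring

/-- The formal power series `∑_n Γ(n+c)/n! X^n = Γ(c) (1-X)^{-c}`. -/
noncomputable def binomSeries (c : ℝ) : PowerSeries ℝ :=
  PowerSeries.mk fun n => Real.Gamma (n + c) / n.factorial

lemma derivative_binomSeries (c : ℝ) :
    PowerSeries.derivative ℝ (binomSeries c) = binomSeries (c + 1) := by
  ext n
  have : ((n.factorial : ℕ) : ℝ) ≠ 0 := by positivity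
  have h : ((n + 1 : ℕ) : ℝ) + c = n + (c + 1) := by push_cast; ring
  simp only [PowerSeries.coeff_derivative, binomSeries, PowerSeries.coeff_mk, h,
    Nat.factorial_succ]
  push_cast
  field_simp

lemma one_sub_X_mul_binomSeries {c : ℝ} (hc : 0 < c) :
    (1 - PowerSeries.X) * binomSeries (c + 1) = PowerSeries.C c * binomSeries c := by
  ext n
  rw [sub_mul, one_mul, map_sub, PowerSeries.coeff_C_mul]
  cases n with
  | zero =>
    simp [binomSeries, Real.Gamma_add_one hc.ne']
  | succ n =>
    have : ((n.factorial : ℕ) : ℝ) ≠ 0 := by positivity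
    have h1 : ((n + 1 : ℕ) : ℝ) + (c + 1) = ((n + 1 : ℕ) + c) + 1 := by ring
    have h2 : (n : ℝ) + (c + 1) = (n + 1 : ℕ) + c := by push_cast; ring
    rw [PowerSeries.coeff_succ_X_mul]
    simp only [binomSeries, PowerSeries.coeff_mk]
    rw [h1, h2, Real.Gamma_add_one (by positivity), Nat.factorial_succ]
    push_cast
    field_simp
    ring

lemma Ring_choose_eq_Gamma {c : ℝ} (hc : 0 < c) (n : ℕ) :
    Ring.choose (c + n - 1) n = Real.Gamma (n + c) / (Real.Gamma c * n.factorial) := by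
  have h1 : Ring.choose (c + n - 1) n = Ring.multichoose c n := by
    rw [Ring.choose]
    congr 1
    ring
  have h2 := Ring.factorial_nsmul_multichoose_eq_ascPochhammer c n
  have h3 : ∀ m : ℕ, Real.Gamma (m + c) =
      Real.Gamma c * Polynomial.smeval (ascPochhammer ℕ m) c := by
    intro m
    induction m with
    | zero => simp
    | succ m ih =>
      rw [Gamma_natCast_succ_add hc, ih, Polynomial.ascPochhammer_smeval_eq_eval,
        Polynomial.ascPochhammer_smeval_eq_eval, ascPochhammer_succ_eval]
      ring
  have h4 : Real.Gamma c ≠ 0 := (Real.Gamma_pos_of_pos hc).ne'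
  rw [h1, h3, ← h2, nsmul_eq_mul]
  field_simp

/-- The binomial series `∑_n Γ(n+c)/n! r^n = Γ(c) (1-r)^{-c}`. -/
lemma hasSum_binomSeries {c : ℝ} (hc : 0 < c) {r : ℝ} (h0 : 0 ≤ r) (h1 : r < 1) :
    HasSum (fun n => PowerSeries.coeff n (binomSeries c) * r ^ n)
      (Real.Gamma c * (1 - r) ^ (-c)) := by
  have hr : r ∈ Metric.eball (0 : ℝ) 1 := by
    simp only [Metric.mem_eball, edist_zero_right]
    rw [← ofReal_norm, ← ENNReal.ofReal_one, ENNReal.ofReal_lt_ofReal_iff one_pos,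
      Real.norm_of_nonneg h0]
    exact h1
  have h := ((Real.one_div_one_sub_rpow_hasFPowerSeriesOnBall_zero c).hasSum hr).mul_left
    (Real.Gamma c)
  have h4 : Real.Gamma c ≠ 0 := (Real.Gamma_pos_of_pos hc).ne'
  refine hasSum_of_eq h (fun n => ?_) ?_
  · simp only [FormalMultilinearSeries.ofScalars_apply_eq, Ring_choose_eq_Gamma hc, binomSeries,
      PowerSeries.coeff_mk, smul_eq_mul]
    field_simp
  · rw [zero_add, Real.rpow_neg (by linarith)]
    ring

lemma hasSum_coeff_mul_X_pow {φ : PowerSeries ℝ} {r v : ℝ}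
    (h : HasSum (fun n => PowerSeries.coeff n φ * r ^ n) v) (N : ℕ) :
    HasSum (fun n => PowerSeries.coeff n (φ * PowerSeries.X ^ N) * r ^ n) (v * r ^ N) := by
  rw [← Function.Injective.hasSum_iff (add_left_injective N)]
  · refine hasSum_of_eq (h.mul_right (r ^ N)) (fun n => ?_) rfl
    rw [Function.comp_apply, PowerSeries.coeff_mul_X_pow]
    ring
  · intro n hn
    have : n < N := by
      by_contra hlt
      exact hn ⟨n - N, Nat.sub_add_cancel (not_lt.1 hlt)⟩
    rw [PowerSeries.coeff_mul_X_pow', if_neg (by omega), zero_mul]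

/-! ### Summation of products of binomial coefficients -/

/-- The coefficient of `r^{i+k-j}` in the closed form of `∑_n Γ(n+c)/n! C(n,i) C(n,k) r^n`,
that is `1/(j! Γ(j+c) (i-j)! (k-j)!)` if `j ≤ min i k` and `0` otherwise. -/
noncomputable def chooseCoeff (c : ℝ) (i k j : ℕ) : ℝ :=
  j.factorial * i.choose j * k.choose j / (i.factorial * k.factorial * Real.Gamma (j + c))

/-- The polynomial `∑_j r^{i+k-j} / (j! Γ(j+c) (i-j)! (k-j)!)`. -/
noncomputable def choosePoly (c : ℝ) (i k : ℕ) : PowerSeries ℝ :=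
  ∑ j ∈ Finset.range (i + 1), PowerSeries.C (chooseCoeff c i k j) * PowerSeries.X ^ (i + k - j)

/-- The power series `∑_n Γ(n+c)/n! C(n,i) C(n,k) X^n`. -/
noncomputable def chooseSeries (c : ℝ) (i k : ℕ) : PowerSeries ℝ :=
  PowerSeries.mk fun n => Real.Gamma (n + c) / n.factorial * n.choose i * n.choose k

lemma natCast_choose_succ (n i : ℕ) :
    ((i : ℝ) + 1) * n.choose (i + 1) = (n - i) * n.choose i := by
  have := Nat.choose_succ_right_eq n i
  rcases le_or_gt i n with h | h
  · have h2 : ((n.choose (i + 1) * (i + 1) : ℕ) : ℝ) = ((n.choose i * (n - i) : ℕ) : ℝ) := by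
      rw [this]
    push_cast [h] at h2
    linarith
  · simp [Nat.choose_eq_zero_of_lt h, Nat.choose_eq_zero_of_lt (Nat.lt_succ_of_lt h)]

lemma chooseSeries_succ (c : ℝ) (i k : ℕ) :
    PowerSeries.C ((i : ℝ) + 1) * chooseSeries c (i + 1) k =
      PowerSeries.X * PowerSeries.derivative ℝ (chooseSeries c i k) -
        PowerSeries.C (i : ℝ) * chooseSeries c i k := by
  ext n
  have h := natCast_choose_succ n i
  rw [map_sub, PowerSeries.coeff_C_mul, PowerSeries.coeff_C_mul]
  cases n with
  | zero =>
    simp [chooseSeries] at h ⊢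
    rcases i with _ | i <;> simp
  | succ n =>
    rw [PowerSeries.coeff_succ_X_mul, PowerSeries.coeff_derivative]
    simp only [chooseSeries, PowerSeries.coeff_mk]
    push_cast at h ⊢
    linear_combination (Real.Gamma (n + 1 + c) / ((n + 1).factorial) * ((n + 1).choose k)) * h

lemma chooseCoeff_recurrence {c : ℝ} (hc : 0 < c) (i k j : ℕ) :
    (i + 1) * (i + c) * chooseCoeff c (i + 1) k (j + 1) =
      (c + i + (j + 1)) * chooseCoeff c i k (j + 1) + (k - j) * chooseCoeff c i k j := by
  have h1 := natCast_choose_succ k j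
  have h2 := natCast_choose_succ i j
  have h3 : ((i + 1).choose (j + 1) : ℝ) = i.choose j + i.choose (j + 1) := by
    rw [Nat.choose_succ_succ]; push_cast; ring
  have hg := (Gamma_natCast_add_pos hc j).ne'
  have hi : (i.factorial : ℝ) ≠ 0 := by positivity
  have hk : (k.factorial : ℝ) ≠ 0 := by positivity
  have hj : (j : ℝ) + c ≠ 0 := by positivity
  have hi1 : (i : ℝ) + 1 ≠ 0 := by positivity
  have hj1 : (j : ℝ) + 1 ≠ 0 := by positivity
  unfold chooseCoeff
  rw [Gamma_natCast_succ_add hc, h3]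
  simp only [Nat.factorial_succ]
  push_cast
  field_simp
  have e1 : (k.choose (j + 1) : ℝ) = (k - j) * k.choose j / (j + 1) := by
    field_simp; linarith
  have e2 : (i.choose (j + 1) : ℝ) = (i - j) * i.choose j / (j + 1) := by
    field_simp; linarith
  rw [e1, e2]
  field_simp
  ring

lemma X_mul_derivative_C_mul_X_pow (a : ℝ) (m : ℕ) :
    PowerSeries.X * PowerSeries.derivative ℝ (PowerSeries.C a * PowerSeries.X ^ m) =
      PowerSeries.C (a * m) * PowerSeries.X ^ m := by
  ext n
  cases n with
  | zero =>
    rcases m with _ | m <;> simp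
  | succ n =>
    rw [PowerSeries.coeff_succ_X_mul, PowerSeries.coeff_derivative, PowerSeries.coeff_C_mul,
      PowerSeries.coeff_C_mul, PowerSeries.coeff_X_pow]
    split_ifs with h
    · subst h; push_cast; ring
    · simp

lemma choosePoly_succ {c : ℝ} (hc : 0 < c) (i k : ℕ) :
    PowerSeries.C (((i : ℝ) + 1) * (i + c)) * choosePoly c (i + 1) k =
      PowerSeries.C (c + i + k) * PowerSeries.X * choosePoly c i k +
      (1 - PowerSeries.X) * (PowerSeries.X * PowerSeries.derivative ℝ (choosePoly c i k)) -
      PowerSeries.C (i : ℝ) * (1 - PowerSeries.X) * choosePoly c i k := by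
  have key : ∀ j ∈ Finset.range (i + 1),
      PowerSeries.C (c + i + k) * PowerSeries.X *
        (PowerSeries.C (chooseCoeff c i k j) * PowerSeries.X ^ (i + k - j)) +
      (1 - PowerSeries.X) * (PowerSeries.X * PowerSeries.derivative ℝ
        (PowerSeries.C (chooseCoeff c i k j) * PowerSeries.X ^ (i + k - j))) -
      PowerSeries.C (i : ℝ) * (1 - PowerSeries.X) *
        (PowerSeries.C (chooseCoeff c i k j) * PowerSeries.X ^ (i + k - j)) =
      PowerSeries.C ((c + i + j) * chooseCoeff c i k j) * PowerSeries.X ^ (i + 1 + k - j) +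
      PowerSeries.C ((k - j) * chooseCoeff c i k j) * PowerSeries.X ^ (i + 1 + k - (j + 1)) := by
    intro j hj
    have hj : j ≤ i := Nat.lt_succ_iff.1 (Finset.mem_range.1 hj)
    rw [X_mul_derivative_C_mul_X_pow]
    have e1 : i + 1 + k - j = (i + k - j) + 1 := by omega
    have e2 : i + 1 + k - (j + 1) = i + k - j := by omega
    rw [e1, e2]
    have e3 : ((i + k - j : ℕ) : ℝ) = i + k - j := by
      rw [Nat.cast_sub (by omega)]; push_cast; ring
    rw [e3]
    simp only [map_mul, map_add, map_sub]
    ring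
  have e : ∀ (A B D : PowerSeries ℝ), A * choosePoly c i k +
      B * (PowerSeries.X * PowerSeries.derivative ℝ (choosePoly c i k)) - D * choosePoly c i k =
      ∑ j ∈ Finset.range (i + 1),
        (A * (PowerSeries.C (chooseCoeff c i k j) * PowerSeries.X ^ (i + k - j)) +
        B * (PowerSeries.X * PowerSeries.derivative ℝ
          (PowerSeries.C (chooseCoeff c i k j) * PowerSeries.X ^ (i + k - j))) -
        D * (PowerSeries.C (chooseCoeff c i k j) * PowerSeries.X ^ (i + k - j))) := by
    intro A B D
    unfold choosePoly
    rw [map_sum, Finset.mul_sum, Finset.mul_sum, Finset.mul_sum, Finset.mul_sum,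
      ← Finset.sum_add_distrib, ← Finset.sum_sub_distrib]
  rw [e, Finset.sum_congr rfl key, Finset.sum_add_distrib, choosePoly, Finset.mul_sum,
    Finset.sum_range_succ',
    Finset.sum_range_succ' (fun j => PowerSeries.C ((c + i + j) * chooseCoeff c i k j) * _)]
  -- the top term `j = i + 1` of the first sum on the right vanishes
  have h0 : (∑ j ∈ Finset.range i, PowerSeries.C ((c + i + (j + 1 : ℕ)) *
        chooseCoeff c i k (j + 1)) * PowerSeries.X ^ (i + 1 + k - (j + 1))) =
      ∑ j ∈ Finset.range (i + 1), PowerSeries.C ((c + i + (j + 1 : ℕ)) *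
        chooseCoeff c i k (j + 1)) * PowerSeries.X ^ (i + 1 + k - (j + 1)) := by
    rw [Finset.sum_range_succ]
    simp [chooseCoeff]
  rw [h0, add_right_comm (Finset.sum _ _), ← Finset.sum_add_distrib]
  congr 1
  · refine Finset.sum_congr rfl fun j _ => ?_
    rw [← mul_assoc, ← map_mul, chooseCoeff_recurrence hc, map_add, add_mul]
    push_cast
    rfl
  · rw [← mul_assoc, ← map_mul]
    congr 2
    have hg := (Real.Gamma_pos_of_pos hc).ne'
    simp [chooseCoeff, Nat.factorial_succ]
    field_simp
    ring

/-- A closed form of `∑_n Γ(n+c)/n! C(n,i) C(n,k) X^n`. It is proved by induction on `i`, since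
`X d/dX - i` raises `i` by one on both sides. -/
lemma chooseSeries_eq {c : ℝ} (hc : 0 < c) (i k : ℕ) :
    chooseSeries c i k =
      PowerSeries.C (Real.Gamma (i + c) * Real.Gamma (k + c) / Real.Gamma (c + i + k)) *
        binomSeries (c + i + k) * choosePoly c i k := by
  induction i with
  | zero =>
    ext n
    have hg := (Real.Gamma_pos_of_pos hc).ne'
    have hg2 : Real.Gamma (c + k) ≠ 0 := by
      rw [add_comm]; exact (Gamma_natCast_add_pos hc k).ne'
    have e : PowerSeries.C (Real.Gamma ((0 : ℕ) + c) * Real.Gamma (k + c) /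
          Real.Gamma (c + (0 : ℕ) + k)) * binomSeries (c + (0 : ℕ) + k) * choosePoly c 0 k =
        PowerSeries.C (1 / k.factorial : ℝ) *
          (binomSeries (c + k) * PowerSeries.X ^ k) := by
      have : PowerSeries.C (Real.Gamma c * Real.Gamma (k + c) / Real.Gamma (c + k)) *
          PowerSeries.C (1 / (k.factorial * Real.Gamma c)) =
          PowerSeries.C (1 / k.factorial : ℝ) := by
        rw [← map_mul, add_comm (k : ℝ) c]
        congr 1
        field_simp
      simp only [choosePoly, chooseCoeff, Nat.cast_zero, zero_add, add_zero, Finset.sum_range_one,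
        Nat.factorial_zero, Nat.choose_zero_right, Nat.cast_one, mul_one, one_mul, Nat.sub_zero]
      rw [← this]
      ring
    rw [e, PowerSeries.coeff_C_mul, PowerSeries.coeff_mul_X_pow']
    simp only [chooseSeries, binomSeries, PowerSeries.coeff_mk, Nat.choose_zero_right, Nat.cast_one,
      mul_one]
    split_ifs with h
    · have e2 : ((n - k : ℕ) : ℝ) + (c + k) = n + c := by rw [Nat.cast_sub h]; ring
      rw [e2, Nat.cast_choose ℝ h]
      have : (n.factorial : ℝ) ≠ 0 := by positivity
      field_simp
    · rw [Nat.choose_eq_zero_of_lt (not_le.1 h)]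
      simp
  | succ i ih =>
    have hi1 : PowerSeries.C ((i : ℝ) + 1) ≠ 0 := by
      rw [Ne, map_eq_zero]
      positivity
    apply mul_left_cancel₀ hi1
    rw [chooseSeries_succ, ih]
    have hp : (0 : ℝ) < c + i + k := by positivity
    have hV := one_sub_X_mul_binomSeries hp
    have hP := choosePoly_succ hc i k
    have hd : PowerSeries.derivative ℝ (PowerSeries.C (Real.Gamma (i + c) * Real.Gamma (k + c) /
          Real.Gamma (c + i + k)) * binomSeries (c + i + k) * choosePoly c i k) =
        PowerSeries.C (Real.Gamma (i + c) * Real.Gamma (k + c) / Real.Gamma (c + i + k)) *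
          (binomSeries (c + i + k + 1) * choosePoly c i k +
            binomSeries (c + i + k) * PowerSeries.derivative ℝ (choosePoly c i k)) := by
      rw [mul_assoc, ← PowerSeries.smul_eq_C_mul, Derivation.map_smul, PowerSeries.smul_eq_C_mul,
        Derivation.leibniz, derivative_binomSeries, smul_eq_mul, smul_eq_mul]
      ring
    rw [hd]
    have e1 : Real.Gamma ((i + 1 : ℕ) + c) * Real.Gamma (k + c) /
        Real.Gamma (c + (i + 1 : ℕ) + k) =
        Real.Gamma (i + c) * Real.Gamma (k + c) / Real.Gamma (c + i + k) *
          ((i + c) * (c + i + k)⁻¹) := by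
      rw [Gamma_natCast_succ_add hc]
      have : c + (i + 1 : ℕ) + k = (c + i + k) + 1 := by push_cast; ring
      rw [this, Real.Gamma_add_one hp.ne']
      have := (Real.Gamma_pos_of_pos hp).ne'
      field_simp
    have e2 : c + (i + 1 : ℕ) + k = c + i + k + 1 := by push_cast; ring
    rw [e1, e2]
    have hs : PowerSeries.C (c + i + k) ≠ 0 := by
      rw [Ne, map_eq_zero]
      exact hp.ne'
    apply mul_left_cancel₀ hs
    have e3 : PowerSeries.C (c + i + k) * PowerSeries.C ((c + i + k)⁻¹) = 1 := by
      rw [← map_mul, mul_inv_cancel₀ hp.ne', map_one]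
    set V := binomSeries (c + i + k)
    set W := binomSeries (c + i + k + 1)
    set P := choosePoly c i k
    set Q := choosePoly c (i + 1) k
    set D := PowerSeries.derivative ℝ P
    set G := PowerSeries.C (Real.Gamma (i + c) * Real.Gamma (k + c) / Real.Gamma (c + i + k))
      with hG
    set S := PowerSeries.C (c + i + k)
    set S' := PowerSeries.C ((c + i + k)⁻¹)
    rw [map_mul] at hP
    have e4 : PowerSeries.C (Real.Gamma (i + c) * Real.Gamma (k + c) / Real.Gamma (c + i + k) *
        ((i + c) * (c + i + k)⁻¹)) = G * (PowerSeries.C ((i : ℝ) + c) * S') := by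
      rw [hG, map_mul (PowerSeries.C) _ (((i : ℝ) + c) * (c + i + k)⁻¹), map_mul]
    rw [e4]
    linear_combination (- G * W) * hP +
      (-G * W * Q * PowerSeries.C ((i : ℝ) + c) * PowerSeries.C ((i : ℝ) + 1)) * e3 +
      (-G * (PowerSeries.X * D - PowerSeries.C (i : ℝ) * P)) * hV

lemma hasSum_chooseSeries {c : ℝ} (hc : 0 < c) (i k : ℕ) {r : ℝ} (h0 : 0 ≤ r) (h1 : r < 1) :
    HasSum (fun n : ℕ => Real.Gamma (n + c) / n.factorial * n.choose i * n.choose k * r ^ n)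
      (Real.Gamma (i + c) * Real.Gamma (k + c) * (1 - r) ^ (-(c + i + k)) *
        ∑ j ∈ Finset.range (i + 1), chooseCoeff c i k j * r ^ (i + k - j)) := by
  have hp : (0 : ℝ) < c + i + k := by positivity
  have hg := (Real.Gamma_pos_of_pos hp).ne'
  have h := hasSum_sum (s := Finset.range (i + 1)) fun j _ =>
    (hasSum_coeff_mul_X_pow (hasSum_binomSeries hp h0 h1) (i + k - j)).mul_left
      (Real.Gamma (i + c) * Real.Gamma (k + c) / Real.Gamma (c + i + k) * chooseCoeff c i k j)
  refine hasSum_of_eq h (fun n => ?_) ?_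
  · have := congrArg (PowerSeries.coeff n) (chooseSeries_eq hc i k)
    rw [chooseSeries, PowerSeries.coeff_mk, choosePoly, Finset.mul_sum, map_sum] at this
    rw [this, Finset.sum_mul]
    refine Finset.sum_congr rfl fun j _ => ?_
    rw [← mul_assoc (_ * chooseCoeff c i k j), ← PowerSeries.coeff_C_mul,
      map_mul (PowerSeries.C) _ (chooseCoeff c i k j)]
    congr 2
    ring
  · rw [Finset.mul_sum]
    refine Finset.sum_congr rfl fun j _ => ?_
    field_simp

/-! ### The Hille–Hardy formula -/

/-- The entire function `∑_j w^j / (j! Γ(j+c))`; the modified Bessel function `I_ν(z)` is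
`(z/2)^ν` times its value at `c = ν + 1`, `w = z²/4`. -/
noncomputable def besselSeries (c w : ℝ) : ℝ :=
  ∑' j : ℕ, w ^ j / (j.factorial * Real.Gamma (j + c))

lemma Gamma_mul_pow_le {c : ℝ} (hc : 0 < c) (j : ℕ) :
    Real.Gamma c * c ^ j ≤ Real.Gamma (j + c) := by
  induction j with
  | zero => simp
  | succ j ih =>
    rw [Gamma_natCast_succ_add hc, pow_succ, ← mul_assoc, mul_comm]
    have : (0 : ℝ) ≤ j := j.cast_nonneg
    have h2 := Real.Gamma_pos_of_pos hc
    exact mul_le_mul (by linarith) ih (by positivity) (by linarith)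

lemma norm_besselSeries_term_le {c : ℝ} (hc : 0 < c) (w : ℝ) (j : ℕ) :
    ‖w ^ j / (j.factorial * Real.Gamma (j + c))‖ ≤
      (Real.Gamma c)⁻¹ * ((|w| / c) ^ j / j.factorial) := by
  have h := Gamma_mul_pow_le hc j
  have h2 := Real.Gamma_pos_of_pos hc
  have h3 := Gamma_natCast_add_pos hc j
  rw [norm_div, norm_pow, Real.norm_eq_abs, norm_mul, Real.norm_of_nonneg h3.le,
    Real.norm_of_nonneg (by positivity)]
  calc |w| ^ j / (j.factorial * Real.Gamma (j + c))
      ≤ |w| ^ j / (j.factorial * (Real.Gamma c * c ^ j)) := by gcongr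
    _ = _ := by rw [div_pow]; field_simp

lemma summable_besselSeries {c : ℝ} (hc : 0 < c) (w : ℝ) :
    Summable fun j : ℕ => w ^ j / (j.factorial * Real.Gamma (j + c)) :=
  .of_norm_bounded ((Real.summable_pow_div_factorial (|w| / c)).mul_left _)
    (norm_besselSeries_term_le hc w)

lemma hasSum_besselSeries {c : ℝ} (hc : 0 < c) (w : ℝ) :
    HasSum (fun j : ℕ => w ^ j / (j.factorial * Real.Gamma (j + c))) (besselSeries c w) :=
  (summable_besselSeries hc w).hasSum

lemma hasSum_exp (u : ℝ) : HasSum (fun p : ℕ => u ^ p / p.factorial) (Real.exp u) := by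
  rw [Real.exp_eq_exp_ℝ]
  exact NormedSpace.expSeries_div_hasSum_exp u

lemma hasSum_mul_real {ι κ : Type*} {f : ι → ℝ} {g : κ → ℝ} {a b : ℝ} (hf : HasSum f a)
    (hg : HasSum g b) : HasSum (fun p : ι × κ => f p.1 * g p.2) (a * b) :=
  hf.mul hg (summable_mul_of_summable_norm hf.summable.norm hg.summable.norm)

lemma chooseCoeff_add {c : ℝ} (hc : 0 < c) (j p q : ℕ) :
    chooseCoeff c (j + p) (j + q) j =
      1 / (j.factorial * Real.Gamma (j + c) * p.factorial * q.factorial) := by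
  have hg := (Gamma_natCast_add_pos hc j).ne'
  unfold chooseCoeff
  rw [Nat.cast_choose ℝ (Nat.le_add_right j p), Nat.cast_choose ℝ (Nat.le_add_right j q),
    Nat.add_sub_cancel_left, Nat.add_sub_cancel_left]
  have h1 : ((j + p).factorial : ℝ) ≠ 0 := by positivity
  have h2 : ((j + q).factorial : ℝ) ≠ 0 := by positivity
  field_simp

/-- The right-hand side of the Hille–Hardy formula, expanded in powers of `x` and `y`. -/
lemma hasSum_chooseCoeff {c : ℝ} (hc : 0 < c) {r : ℝ} (h1 : r < 1) (x y : ℝ) :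
    HasSum (fun p : ℕ × ℕ => (-x) ^ p.1 * (-y) ^ p.2 * ((1 - r) ^ (-(c + p.1 + p.2)) *
        ∑ j ∈ Finset.range (p.1 + 1), chooseCoeff c p.1 p.2 j * r ^ (p.1 + p.2 - j)))
      ((1 - r) ^ (-c) * Real.exp (-(r / (1 - r)) * x) * Real.exp (-(r / (1 - r)) * y) *
        besselSeries c (x * y * r / (1 - r) ^ 2)) := by
  have hr : 0 < 1 - r := by linarith
  have h := (hasSum_mul_real (hasSum_mul_real (hasSum_besselSeries hc (x * y * r / (1 - r) ^ 2))
    (hasSum_exp (-(r / (1 - r)) * x))) (hasSum_exp (-(r / (1 - r)) * y))).mul_left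
      ((1 - r) ^ (-c))
  let e : (ℕ × ℕ) × ℕ → (ℕ × ℕ) × ℕ := fun t => ((t.1.1 + t.1.2, t.1.1 + t.2), t.1.1)
  have he : Function.Injective e := by
    rintro ⟨⟨j, p⟩, q⟩ ⟨⟨j', p'⟩, q'⟩ h
    simp only [e, Prod.mk.injEq] at h ⊢
    omega
  let T : (ℕ × ℕ) × ℕ → ℝ := fun t =>
    (-x) ^ t.1.1 * (-y) ^ t.1.2 * ((1 - r) ^ (-(c + t.1.1 + t.1.2)) *
      (chooseCoeff c t.1.1 t.1.2 t.2 * r ^ (t.1.1 + t.1.2 - t.2)))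
  have hT : HasSum (T ∘ e) ((1 - r) ^ (-c) * Real.exp (-(r / (1 - r)) * x) *
      Real.exp (-(r / (1 - r)) * y) * besselSeries c (x * y * r / (1 - r) ^ 2)) := by
    refine hasSum_of_eq h (fun t => ?_) (by ring)
    obtain ⟨⟨j, p⟩, q⟩ := t
    have e1 : j + p + (j + q) - j = j + p + q := by omega
    have e2 : (1 - r) ^ (-(c + (j + p : ℕ) + (j + q : ℕ))) =
        (1 - r) ^ (-c) * ((1 - r) ^ (j + p + (j + q)))⁻¹ := by
      rw [← Real.rpow_natCast, ← Real.rpow_neg hr.le, ← Real.rpow_add hr]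
      congr 1
      push_cast
      ring
    have hg := (Gamma_natCast_add_pos hc j).ne'
    simp only [T, e, Function.comp_apply, chooseCoeff_add hc, e1, e2]
    have e3 : (-(r / (1 - r)) * x) ^ p = (-x) ^ p * (r ^ p / (1 - r) ^ p) := by
      rw [← div_pow, ← mul_pow]; congr 1; ring
    have e4 : (-(r / (1 - r)) * y) ^ q = (-y) ^ q * (r ^ q / (1 - r) ^ q) := by
      rw [← div_pow, ← mul_pow]; congr 1; ring
    have e5 : (x * y * r / (1 - r) ^ 2) ^ j =
        (-x) ^ j * (-y) ^ j * r ^ j / ((1 - r) ^ j * (1 - r) ^ j) := by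
      rw [← mul_pow, ← mul_pow, ← mul_pow, ← div_pow]; congr 1; ring
    rw [e3, e4, e5]
    simp only [pow_add]
    field_simp
  rw [he.hasSum_iff] at hT
  · refine hT.prod_fiberwise fun p => ?_
    have := hasSum_sum_of_ne_finset_zero (f := fun j => T (p, j)) (s := Finset.range (p.1 + 1))
      (L := .unconditional ℕ) ?_
    · refine hasSum_of_eq this (fun _ => rfl) ?_
      simp only [T, Finset.mul_sum]
    · intro j hj
      have : p.1 < j := by
        simpa [Nat.lt_succ_iff] using hj
      simp [T, chooseCoeff, Nat.choose_eq_zero_of_lt this]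
  · rintro ⟨⟨i, k⟩, j⟩ hn
    by_cases hi : j ≤ i
    · by_cases hk : j ≤ k
      · refine absurd ⟨((j, i - j), k - j), ?_⟩ hn
        simp only [e, Prod.mk.injEq, and_true]
        omega
      · simp [T, chooseCoeff, Nat.choose_eq_zero_of_lt (not_le.1 hk)]
    · simp [T, chooseCoeff, Nat.choose_eq_zero_of_lt (not_le.1 hi)]

/-- The Laguerre polynomial of order `c - 1`, normalized as `n!/Γ(n+c) L_n^{c-1}`. -/
noncomputable def laguerreN (c : ℝ) (n : ℕ) (x : ℝ) : ℝ :=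
  ∑ i ∈ Finset.range (n + 1), n.choose i * (-x) ^ i / Real.Gamma (i + c)

/-- The Hille–Hardy formula, in terms of the polynomials `n!/Γ(n+c) L_n^{c-1}`. -/
lemma hasSum_hilleHardy {c : ℝ} (hc : 0 < c) {r : ℝ} (h0 : 0 ≤ r) (h1 : r < 1) (x y : ℝ) :
    HasSum (fun n : ℕ => Real.Gamma (n + c) / n.factorial * laguerreN c n x * laguerreN c n y *
        r ^ n)
      ((1 - r) ^ (-c) * Real.exp (-(r / (1 - r)) * x) * Real.exp (-(r / (1 - r)) * y) *
        besselSeries c (x * y * r / (1 - r) ^ 2)) := by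
  have hr : 0 < 1 - r := by linarith
  let B : ℝ → ℝ → (ℕ × ℕ) × ℕ → ℝ := fun x y t =>
    (-x) ^ t.1.1 * (-y) ^ t.1.2 / (Real.Gamma (t.1.1 + c) * Real.Gamma (t.1.2 + c)) *
      (Real.Gamma (t.2 + c) / t.2.factorial * t.2.choose t.1.1 * t.2.choose t.1.2 * r ^ t.2)
  have hB1 : ∀ x y (p : ℕ × ℕ), HasSum (fun n => B x y (p, n))
      ((-x) ^ p.1 * (-y) ^ p.2 * ((1 - r) ^ (-(c + p.1 + p.2)) *
        ∑ j ∈ Finset.range (p.1 + 1), chooseCoeff c p.1 p.2 j * r ^ (p.1 + p.2 - j))) := by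
    intro x y p
    refine hasSum_of_eq ((hasSum_chooseSeries hc p.1 p.2 h0 h1).mul_left
      ((-x) ^ p.1 * (-y) ^ p.2 / (Real.Gamma (p.1 + c) * Real.Gamma (p.2 + c))))
      (fun n => rfl) ?_
    have := (Gamma_natCast_add_pos hc p.1).ne'
    have := (Gamma_natCast_add_pos hc p.2).ne'
    field_simp
  have hpos : ∀ n : ℕ, 0 < Real.Gamma (n + c) := Gamma_natCast_add_pos hc
  have hnorm : ∀ t, ‖B x y t‖ = B (-|x|) (-|y|) t := by
    intro t
    have := hpos t.1.1
    have := hpos t.1.2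
    have := hpos t.2
    simp only [B, neg_neg]
    rw [norm_mul, norm_div, norm_mul, norm_pow, norm_pow, norm_neg, norm_neg, Real.norm_eq_abs x,
      Real.norm_eq_abs y, Real.norm_of_nonneg (mul_pos (hpos t.1.1) (hpos t.1.2)).le,
      Real.norm_of_nonneg (by positivity)]
  have hsum : Summable (B x y) := by
    apply Summable.of_norm
    rw [funext hnorm, summable_prod_of_nonneg]
    · refine ⟨fun p => (hB1 _ _ p).summable, ?_⟩
      simp only [fun p => (hB1 (-|x|) (-|y|) p).tsum_eq]
      exact (hasSum_chooseCoeff hc h1 _ _).summable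
    · intro t
      rw [← hnorm]
      exact norm_nonneg _
  have htot := hsum.hasSum
  rw [(htot.prod_fiberwise (hB1 x y)).unique (hasSum_chooseCoeff hc h1 x y),
    ← (Equiv.prodComm ℕ (ℕ × ℕ)).hasSum_iff] at htot
  refine htot.prod_fiberwise fun n => ?_
  have hfin := hasSum_sum_of_ne_finset_zero (f := fun p => B x y (p, n))
    (s := Finset.range (n + 1) ×ˢ Finset.range (n + 1)) (L := .unconditional (ℕ × ℕ)) ?_
  · refine hasSum_of_eq hfin (fun _ => rfl) ?_
    rw [Finset.sum_product, mul_assoc (Real.Gamma (n + c) / n.factorial), laguerreN, laguerreN,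
      Finset.sum_mul_sum, Finset.mul_sum, Finset.sum_mul]
    refine Finset.sum_congr rfl fun i _ => ?_
    rw [Finset.mul_sum, Finset.sum_mul]
    refine Finset.sum_congr rfl fun k _ => ?_
    simp only [B]
    have := (hpos i).ne'
    have := (hpos k).ne'
    field_simp
  · rintro ⟨i, k⟩ hp
    simp only [Finset.mem_product, Finset.mem_range, Nat.lt_succ_iff, not_and_or, not_le] at hp
    rcases hp with hp | hp <;> simp [B, Nat.choose_eq_zero_of_lt hp]

/-! ### The heat kernel as a series of generalized Hermite functions -/

lemma laguerre_eq_laguerreN (b : ℝ) (n : ℕ) (x : ℝ) :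
    laguerre b n x = Real.Gamma (n + (b + 1)) / n.factorial * laguerreN (b + 1) n x := by
  rw [laguerre, laguerreN, Finset.mul_sum]
  refine Finset.sum_congr rfl fun j hj => ?_
  have hj : j ≤ n := Nat.lt_succ_iff.1 (Finset.mem_range.1 hj)
  rw [Nat.cast_choose ℝ hj, neg_pow x, add_assoc, add_assoc]
  have : (n.factorial : ℝ) ≠ 0 := by positivity
  field_simp

/-- Even and odd generalized Hermite functions in a single formula, with `c = a + e + 1`. -/
lemma hermite₁_two_mul_add {a : ℝ} (ha : -1 / 2 ≤ a) (e : Fin 2) (n : ℕ) (x : ℝ) :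
    hermite₁ a (2 * n + e) x = (-1) ^ n * √(Real.Gamma (n + (a + (e : ℕ) + 1)) / n.factorial) *
      Real.exp (-x ^ 2 / 2) * x ^ (e : ℕ) * laguerreN (a + (e : ℕ) + 1) n (x ^ 2) := by
  have hs : ∀ G : ℝ, 0 < G → √(n.factorial / G) * (G / n.factorial) = √(G / n.factorial) := by
    intro G hG
    have hn : (0 : ℝ) < n.factorial := by positivity
    rw [← inv_div G, Real.sqrt_inv]
    have h := Real.sq_sqrt (div_pos hG hn).le
    have h2 := Real.sqrt_pos.2 (div_pos hG hn)
    nth_rw 2 [← h]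
    field_simp
  obtain he | he : (e : ℕ) = 0 ∨ (e : ℕ) = 1 := by omega
  · have hG : 0 < Real.Gamma (n + (a + 1)) := Gamma_natCast_add_pos (by linarith) n
    have e1 : (2 * n + 0) % 2 = 0 := by omega
    have e2 : (2 * n + 0) / 2 = n := by omega
    rw [he, hermite₁, if_pos e1, e2, laguerre_eq_laguerreN, Nat.cast_zero, add_zero, ← hs _ hG,
      add_assoc]
    ring
  · have hG : 0 < Real.Gamma (n + (a + 1 + 1)) := Gamma_natCast_add_pos (by linarith) n
    have e1 : ¬ (2 * n + 1) % 2 = 0 := by omega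
    have e2 : (2 * n + 1) / 2 = n := by omega
    rw [he, hermite₁, if_neg e1, e2, laguerre_eq_laguerreN, Nat.cast_one, ← hs _ hG,
      show (n : ℝ) + a + 2 = n + (a + 1 + 1) by ring]
    ring

/-- One coordinate of the component heat kernel, with `c = α_i + ε_i + 1` and `e = ε_i`. -/
noncomputable def heatKernel₁ (c : ℝ) (e : ℕ) (t x y : ℝ) : ℝ :=
  (x * y) ^ e * (2 * Real.sinh (2 * t)) ^ (-c) *
    Real.exp (-(1 / 2) * (Real.cosh (2 * t) / Real.sinh (2 * t)) * (x ^ 2 + y ^ 2)) *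
    besselSeries c ((x * y / (2 * Real.sinh (2 * t))) ^ 2)

lemma besselI_eq (ν : ℝ) {z : ℝ} (hz : 0 < z) :
    besselI ν z = (z / 2) ^ ν * besselSeries (ν + 1) ((z / 2) ^ 2) := by
  rw [besselI, besselSeries, ← tsum_mul_left]
  congr 1
  ext j
  rw [Real.rpow_add (by positivity), ← pow_mul, ← Real.rpow_natCast _ (2 * j), add_assoc]
  push_cast
  ring

lemma sinh_two_mul_pos {t : ℝ} (ht : 0 < t) : 0 < Real.sinh (2 * t) :=
  Real.sinh_pos_iff.2 (by linarith)

lemma heatKernel_eq_prod {d : ℕ} (α : Fin d → ℝ) (ε : Fin d → Fin 2) {t : ℝ} (ht : 0 < t)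
    {x y : Fin d → ℝ} (hx : x ∈ orthant d) (hy : y ∈ orthant d) :
    heatKernel α ε t x y =
      ∏ i, heatKernel₁ (α i + (ε i : ℕ) + 1) (ε i : ℕ) t (x i) (y i) := by
  have hs := sinh_two_mul_pos ht
  have e1 : ((2 * Real.sinh (2 * t)) ^ d)⁻¹ = ∏ _i : Fin d, (2 * Real.sinh (2 * t))⁻¹ := by
    rw [Finset.prod_const, Finset.card_univ, Fintype.card_fin, inv_pow]
  have e2 : Real.exp (-(1 / 2) * (Real.cosh (2 * t) / Real.sinh (2 * t)) *
      (∑ i, x i ^ 2 + ∑ i, y i ^ 2)) = ∏ i, Real.exp (-(1 / 2) *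
        (Real.cosh (2 * t) / Real.sinh (2 * t)) * (x i ^ 2 + y i ^ 2)) := by
    rw [← Real.exp_sum, ← Finset.sum_add_distrib, Finset.mul_sum]
  rw [heatKernel, e1, e2, ← Finset.prod_mul_distrib, ← Finset.prod_mul_distrib]
  refine Finset.prod_congr rfl fun i _ => ?_
  have hxy : 0 < x i * y i := mul_pos (hx i (mem_univ i)) (hy i (mem_univ i))
  rw [besselI_eq _ (div_pos hxy hs), heatKernel₁]
  have e3 : x i * y i / Real.sinh (2 * t) / 2 = x i * y i / (2 * Real.sinh (2 * t)) := by
    field_simp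
  have h2 : 0 < 2 * Real.sinh (2 * t) := by positivity
  rw [e3, Real.div_rpow hxy.le h2.le, neg_add, Real.rpow_add h2 _ (-1),
    Real.rpow_neg_one, Real.rpow_neg h2.le]
  have := (Real.rpow_pos_of_pos hxy (α i + (ε i : ℕ))).ne'
  field_simp

/-- The one-dimensional Mehler formula. -/
lemma hasSum_heatKernel₁ {a : ℝ} (ha : -1 / 2 ≤ a) (e : Fin 2) {t : ℝ} (ht : 0 < t) (x y : ℝ) :
    HasSum (fun k : ℕ => if k % 2 = (e : ℕ) then
        Real.exp (-t * (2 * k + 2 * a + 2)) * (hermite₁ a k x * hermite₁ a k y) else 0)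
      (heatKernel₁ (a + (e : ℕ) + 1) (e : ℕ) t x y) := by
  set c := a + (e : ℕ) + 1 with hcdef
  have hc : 0 < c := by
    have : (0 : ℝ) ≤ ((e : ℕ) : ℝ) := Nat.cast_nonneg _
    linarith
  have hinj : Function.Injective fun n : ℕ => 2 * n + (e : ℕ) := fun m n h => by
    simp only at h
    omega
  have he : (e : ℕ) < 2 := e.2
  rw [← hinj.hasSum_iff]
  · have hs := sinh_two_mul_pos ht
    set E := Real.exp (-2 * t) with hE
    have hE0 : 0 < E := Real.exp_pos _
    have hE1 : E < 1 := by
      rw [hE, Real.exp_lt_one_iff]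
      linarith
    have hr : 0 < 1 - E ^ 2 := by nlinarith
    have hEinv : Real.exp (2 * t) = E⁻¹ := by
      rw [hE, ← Real.exp_neg]
      congr 1
      ring
    have hsinh : Real.sinh (2 * t) = (1 - E ^ 2) / (2 * E) := by
      rw [Real.sinh_eq, hEinv, ← neg_mul, ← hE]
      field_simp
    have hcosh : Real.cosh (2 * t) = (1 + E ^ 2) / (2 * E) := by
      rw [Real.cosh_eq, hEinv, ← neg_mul, ← hE]
      field_simp
    have h := (hasSum_hilleHardy hc (r := E ^ 2) (by positivity) (by linarith) (x ^ 2)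
      (y ^ 2)).mul_left ((x * y) ^ (e : ℕ) * Real.exp (-t * (2 * c)) *
        Real.exp (-x ^ 2 / 2) * Real.exp (-y ^ 2 / 2))
    refine hasSum_of_eq h (fun n => ?_) ?_
    · have e1 : (2 * n + (e : ℕ)) % 2 = e := by omega
      have e2 : Real.exp (-t * (2 * (2 * n + (e : ℕ) : ℕ) + 2 * a + 2)) =
          Real.exp (-t * (2 * c)) * (E ^ 2) ^ n := by
        rw [hE, ← pow_mul, ← Real.exp_nat_mul, ← Real.exp_add]
        congr 1
        rw [hcdef]
        push_cast
        ring
      simp only [Function.comp_apply, if_pos e1, e2, hermite₁_two_mul_add ha, ← hcdef]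
      have e3 : √(Real.Gamma (n + c) / n.factorial) * √(Real.Gamma (n + c) / n.factorial) =
          Real.Gamma (n + c) / n.factorial :=
        Real.mul_self_sqrt (div_nonneg (Gamma_natCast_add_pos hc n).le (by positivity))
      have e4 : ((-1 : ℝ) ^ n) * (-1) ^ n = 1 := by
        rw [← mul_pow]
        simp
      rw [mul_pow]
      set q := √(Real.Gamma (n + c) / n.factorial)
      linear_combination (Real.exp (-t * (2 * c)) * (E ^ 2) ^ n *
        Real.exp (-x ^ 2 / 2) * x ^ (e : ℕ) * laguerreN c n (x ^ 2) *
        Real.exp (-y ^ 2 / 2) * y ^ (e : ℕ) * laguerreN c n (y ^ 2)) * (q * q * e4 + e3)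
    · have e1 : Real.exp (-t * (2 * c)) * (1 - E ^ 2) ^ (-c) =
          (2 * Real.sinh (2 * t)) ^ (-c) := by
        have : Real.exp (-t * (2 * c)) = (E⁻¹) ^ (-c) := by
          rw [Real.inv_rpow hE0.le, Real.rpow_neg hE0.le, inv_inv, hE, ← Real.exp_mul]
          congr 1
          ring
        rw [this, ← Real.mul_rpow (by positivity) hr.le, hsinh]
        congr 1
        field_simp
      have e2 : Real.exp (-(1 / 2) * (Real.cosh (2 * t) / Real.sinh (2 * t)) *
          (x ^ 2 + y ^ 2)) = Real.exp (-x ^ 2 / 2) * Real.exp (-y ^ 2 / 2) *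
          Real.exp (-(E ^ 2 / (1 - E ^ 2)) * x ^ 2) *
          Real.exp (-(E ^ 2 / (1 - E ^ 2)) * y ^ 2) := by
        rw [← Real.exp_add, ← Real.exp_add, ← Real.exp_add, hsinh, hcosh]
        congr 1
        field_simp
        ring
      have e3 : (x * y / (2 * Real.sinh (2 * t))) ^ 2 =
          x ^ 2 * y ^ 2 * E ^ 2 / (1 - E ^ 2) ^ 2 := by
        rw [hsinh]
        field_simp
      rw [heatKernel₁, ← e1, e2, e3]
      ring
  · intro k hk
    have : ¬ k % 2 = (e : ℕ) := fun h => hk ⟨k / 2, by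
      show 2 * (k / 2) + (e : ℕ) = k
      omega⟩
    simp [this]

lemma hasSum_fin_prod {d : ℕ} {f : Fin d → ℕ → ℝ} {a : Fin d → ℝ}
    (h : ∀ i, HasSum (f i) (a i)) :
    HasSum (fun k : Fin d → ℕ => ∏ i, f i (k i)) (∏ i, a i) := by
  induction d with
  | zero => simp
  | succ d ih =>
    rw [← (Fin.consEquiv fun _ : Fin (d + 1) => ℕ).hasSum_iff, Fin.prod_univ_succ]
    refine hasSum_of_eq (hasSum_mul_real (h 0) (ih fun i => h i.succ)) (fun p => ?_) rfl
    simp [Fin.prod_univ_succ, Fin.consEquiv]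

lemma eigenvalue_sum {d : ℕ} (α : Fin d → ℝ) (k : Fin d → ℕ) :
    eigenvalue α (∑ i, k i) = ∑ i, (2 * (k i : ℝ) + 2 * α i + 2) := by
  rw [Finset.sum_add_distrib, Finset.sum_add_distrib, ← Finset.mul_sum, ← Finset.mul_sum,
    eigenvalue]
  simp
  ring

lemma prod_ite_eq_ite_forall {d : ℕ} (p : Fin d → Prop) [∀ i, Decidable (p i)]
    (f : Fin d → ℝ) : ∏ i, (if p i then f i else 0) = if ∀ i, p i then ∏ i, f i else 0 := by
  split_ifs with h
  · exact Finset.prod_congr rfl fun i _ => if_pos (h i)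
  · obtain ⟨i, hi⟩ := not_forall.1 h
    exact Finset.prod_eq_zero (Finset.mem_univ i) (if_neg hi)

/-- Mehler's formula for the component heat kernel: it is the integral kernel of the restriction of
`e^{-t𝓛_α}` to the span of the `h_k^α` with `k` of parity `ε`. -/
lemma hasSum_heatKernel {d : ℕ} {α : Fin d → ℝ} (hα : ∀ i, -1 / 2 ≤ α i) (ε : Fin d → Fin 2)
    {t : ℝ} (ht : 0 < t) {x y : Fin d → ℝ} (hx : x ∈ orthant d) (hy : y ∈ orthant d) :
    HasSum (fun k : Fin d → ℕ => if ∀ i, k i % 2 = (ε i : ℕ) then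
        Real.exp (-t * eigenvalue α (∑ i, k i)) * (hermite α k x * hermite α k y) else 0)
      (heatKernel α ε t x y) := by
  rw [heatKernel_eq_prod α ε ht hx hy]
  refine hasSum_of_eq (hasSum_fin_prod fun i => hasSum_heatKernel₁ (hα i) (ε i) ht (x i) (y i))
    (fun k => ?_) rfl
  rw [prod_ite_eq_ite_forall, Finset.prod_mul_distrib, Finset.prod_mul_distrib, ← Real.exp_sum,
    ← Finset.mul_sum, ← eigenvalue_sum]
  rfl

/-! ### Orthogonality of the generalized Hermite functions -/

lemma sum_alternating_choose_succ (n : ℕ) (f : ℕ → ℝ) :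
    ∑ i ∈ Finset.range (n + 2), (-1) ^ i * ((n + 1).choose i : ℝ) * f i =
      ∑ i ∈ Finset.range (n + 1), (-1) ^ i * (n.choose i : ℝ) * (f i - f (i + 1)) := by
  have h : ∀ i, ((n + 1).choose (i + 1) : ℝ) = n.choose i + n.choose (i + 1) := fun i => by
    rw [Nat.choose_succ_succ]
    push_cast
    rfl
  have h2 : ∑ i ∈ Finset.range (n + 1), (-1 : ℝ) ^ i * (n.choose i : ℝ) * f i =
      ∑ i ∈ Finset.range (n + 1), (-1 : ℝ) ^ (i + 1) * (n.choose (i + 1) : ℝ) * f (i + 1) +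
        f 0 := by
    rw [Finset.sum_range_succ', Finset.sum_range_succ _ n]
    simp
  rw [Finset.sum_range_succ']
  simp only [h, mul_sub, Finset.sum_sub_distrib, h2, mul_add, add_mul, Finset.sum_add_distrib]
  have h3 : ∑ i ∈ Finset.range (n + 1), (-1 : ℝ) ^ (i + 1) * (n.choose i : ℝ) * f (i + 1) =
      -∑ i ∈ Finset.range (n + 1), (-1 : ℝ) ^ i * (n.choose i : ℝ) * f (i + 1) := by
    rw [← Finset.sum_neg_distrib]
    exact Finset.sum_congr rfl fun i _ => by ring
  rw [h3]
  simp
  ring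

/-- The `n`th finite difference of `i ↦ Γ(i+j+c)/Γ(i+c)`, a polynomial of degree `j` in `i`. -/
lemma sum_alternating_choose_Gamma {c : ℝ} (hc : 0 < c) (n j : ℕ) :
    ∑ i ∈ Finset.range (n + 1),
        (-1) ^ i * (n.choose i : ℝ) * (Real.Gamma (i + j + c) / Real.Gamma (i + c)) =
      (-1) ^ n * j.descFactorial n * (Real.Gamma (j + c) / Real.Gamma (n + c)) := by
  induction n generalizing c j with
  | zero => simp
  | succ n ih =>
    rw [sum_alternating_choose_succ n fun i => Real.Gamma (i + j + c) / Real.Gamma (i + c)]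
    cases j with
    | zero =>
      rw [Nat.zero_descFactorial_succ]
      have h : ∀ i : ℕ, Real.Gamma (i + (0 : ℝ) + c) / Real.Gamma (i + c) = 1 := fun i => by
        rw [add_zero, div_self (Gamma_natCast_add_pos hc i).ne']
      rw [Nat.cast_zero, mul_zero, zero_mul]
      exact Finset.sum_eq_zero fun i _ => by rw [h, h, sub_self, mul_zero]
    | succ j =>
      have hc1 : 0 < c + 1 := by linarith
      have key : ∀ i : ℕ, Real.Gamma (i + (j + 1 : ℕ) + c) / Real.Gamma (i + c) -
          Real.Gamma ((i + 1 : ℕ) + (j + 1 : ℕ) + c) / Real.Gamma ((i + 1 : ℕ) + c) =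
          -(j + 1) * (Real.Gamma (i + j + (c + 1)) / Real.Gamma (i + (c + 1))) := by
        intro i
        have e1 : ((i + 1 : ℕ) : ℝ) + (j + 1 : ℕ) + c = (i + (j + 1) + c) + 1 := by
          push_cast; ring
        have e2 : ((i + 1 : ℕ) : ℝ) + c = (i + c) + 1 := by push_cast; ring
        have e3 : (i : ℝ) + j + (c + 1) = i + (j + 1) + c := by ring
        have e4 : (i : ℝ) + (c + 1) = (i + c) + 1 := by ring
        rw [e1, e2, e3, e4, Real.Gamma_add_one (by positivity),
          Real.Gamma_add_one (by positivity : (i : ℝ) + c ≠ 0)]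
        have := (Gamma_natCast_add_pos hc i).ne'
        have : (i : ℝ) + c ≠ 0 := by positivity
        push_cast
        field_simp
        ring
      have e : ∀ i ∈ Finset.range (n + 1), (-1 : ℝ) ^ i * (n.choose i : ℝ) *
          (Real.Gamma (i + (j + 1 : ℕ) + c) / Real.Gamma (i + c) -
          Real.Gamma ((i + 1 : ℕ) + (j + 1 : ℕ) + c) / Real.Gamma ((i + 1 : ℕ) + c)) =
          -(j + 1) * ((-1) ^ i * (n.choose i : ℝ) *
            (Real.Gamma (i + j + (c + 1)) / Real.Gamma (i + (c + 1)))) := by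
        intro i _
        rw [key]
        ring
      rw [Finset.sum_congr rfl e, ← Finset.mul_sum, ih hc1, Nat.succ_descFactorial_succ]
      have e1 : ((j + 1 : ℕ) : ℝ) + c = j + (c + 1) := by push_cast; ring
      have e2 : ((n + 1 : ℕ) : ℝ) + c = n + (c + 1) := by push_cast; ring
      rw [e1, e2]
      push_cast
      ring

lemma integrable_moment {c : ℝ} (hc : 0 < c) (p : ℕ) :
    Integrable (fun x : ℝ => x ^ (2 * p) * (x ^ (2 * c - 1) * Real.exp (-x ^ 2)))
      (volume.restrict (Ioi 0)) := by
  have h := integrableOn_rpow_mul_exp_neg_rpow (p := 2) (s := 2 * p + (2 * c - 1))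
    (by have : (0 : ℝ) ≤ p := p.cast_nonneg
        linarith) two_pos
  refine h.congr_fun (fun x hx => ?_) measurableSet_Ioi
  have hx : (0 : ℝ) < x := hx
  simp only [Real.rpow_add hx, Real.rpow_two]
  rw [← Real.rpow_natCast x (2 * p)]
  push_cast
  ring

lemma integral_moment {c : ℝ} (hc : 0 < c) (p : ℕ) :
    ∫ x in Ioi (0 : ℝ), x ^ (2 * p) * (x ^ (2 * c - 1) * Real.exp (-x ^ 2)) =
      Real.Gamma (p + c) / 2 := by
  have h := integral_rpow_mul_exp_neg_rpow (p := 2) (q := 2 * p + (2 * c - 1)) two_pos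
    (by have : (0 : ℝ) ≤ p := p.cast_nonneg
        linarith)
  have e : (2 * (p : ℝ) + (2 * c - 1) + 1) / 2 = p + c := by ring
  rw [e] at h
  rw [div_eq_mul_one_div, mul_comm (Real.Gamma _), ← h]
  refine setIntegral_congr_fun measurableSet_Ioi fun x hx => ?_
  have hx : (0 : ℝ) < x := hx
  simp only [Real.rpow_add hx, Real.rpow_two]
  rw [← Real.rpow_natCast x (2 * p)]
  push_cast
  ring

lemma laguerreN_mul_laguerreN (c : ℝ) (n m : ℕ) (x w : ℝ) :
    laguerreN c n (x ^ 2) * laguerreN c m (x ^ 2) * w =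
      ∑ j ∈ Finset.range (m + 1), ∑ i ∈ Finset.range (n + 1),
        ((-1) ^ j * m.choose j / Real.Gamma (j + c) *
          ((-1) ^ i * n.choose i / Real.Gamma (i + c))) * (x ^ (2 * (i + j)) * w) := by
  rw [mul_comm (laguerreN c n _), laguerreN, laguerreN, Finset.sum_mul_sum, Finset.sum_mul]
  refine Finset.sum_congr rfl fun j _ => ?_
  rw [Finset.sum_mul]
  refine Finset.sum_congr rfl fun i _ => ?_
  rw [neg_pow (x ^ 2) i, neg_pow (x ^ 2) j]
  ring

lemma integral_laguerreN_of_le {c : ℝ} (hc : 0 < c) {n m : ℕ} (hmn : m ≤ n) :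
    ∫ x in Ioi (0 : ℝ), laguerreN c n (x ^ 2) * laguerreN c m (x ^ 2) *
        (x ^ (2 * c - 1) * Real.exp (-x ^ 2)) =
      if n = m then n.factorial / (2 * Real.Gamma (n + c)) else 0 := by
  simp only [laguerreN_mul_laguerreN]
  rw [integral_finsetSum _ fun j _ => integrable_finsetSum _ fun i _ =>
    (integrable_moment hc _).const_mul _]
  have e : ∀ j ∈ Finset.range (m + 1),
      (∫ x in Ioi (0 : ℝ), ∑ i ∈ Finset.range (n + 1),
        ((-1) ^ j * m.choose j / Real.Gamma (j + c) *
          ((-1) ^ i * n.choose i / Real.Gamma (i + c))) *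
          (x ^ (2 * (i + j)) * (x ^ (2 * c - 1) * Real.exp (-x ^ 2)))) =
      (-1) ^ j * m.choose j / 2 * ((-1) ^ n * j.descFactorial n / Real.Gamma (n + c)) := by
    intro j _
    rw [integral_finsetSum _ fun i _ => (integrable_moment hc _).const_mul _]
    simp only [integral_const_mul, integral_moment hc]
    have hj := (Gamma_natCast_add_pos hc j).ne'
    have h := sum_alternating_choose_Gamma hc n j
    calc _ = (-1) ^ j * m.choose j / (2 * Real.Gamma (j + c)) *
          ∑ i ∈ Finset.range (n + 1),
            (-1) ^ i * (n.choose i : ℝ) * (Real.Gamma (i + j + c) / Real.Gamma (i + c)) := by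
          rw [Finset.mul_sum]
          refine Finset.sum_congr rfl fun i _ => ?_
          push_cast
          field_simp
      _ = _ := by
          rw [h]
          field_simp
  rw [Finset.sum_congr rfl e]
  -- `j.descFactorial n` vanishes for `j < n`, so that at most the term `j = m = n` survives
  split_ifs with hnm
  · subst hnm
    rw [Finset.sum_eq_single_of_mem n (by simp)]
    · rw [Nat.choose_self, Nat.descFactorial_self]
      have : ((-1 : ℝ) ^ n) * (-1) ^ n = 1 := by
        rw [← mul_pow]
        simp
      push_cast
      linear_combination (n.factorial / (2 * Real.Gamma (n + c))) * this
    · intro j hj hjn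
      have : j < n := by
        have := Finset.mem_range.1 hj
        omega
      simp [Nat.descFactorial_of_lt this]
  · refine Finset.sum_eq_zero fun j hj => ?_
    have : j < n := by
      have := Finset.mem_range.1 hj
      omega
    simp [Nat.descFactorial_of_lt this]

lemma integral_laguerreN {c : ℝ} (hc : 0 < c) (n m : ℕ) :
    ∫ x in Ioi (0 : ℝ), laguerreN c n (x ^ 2) * laguerreN c m (x ^ 2) *
        (x ^ (2 * c - 1) * Real.exp (-x ^ 2)) =
      if n = m then n.factorial / (2 * Real.Gamma (n + c)) else 0 := by
  rcases le_total m n with h | h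
  · exact integral_laguerreN_of_le hc h
  · simp only [mul_comm (laguerreN c n _)]
    rw [integral_laguerreN_of_le hc h]
    by_cases hnm : n = m
    · simp [hnm]
    · simp [hnm, Ne.symm hnm]

/-- Generalized Hermite functions of the same parity are orthogonal on the half-line; each has
squared norm `1/2`. -/
lemma integral_hermite₁_mul {a : ℝ} (ha : -1 / 2 ≤ a) {k l : ℕ} (h : k % 2 = l % 2) :
    ∫ x in Ioi (0 : ℝ), hermite₁ a k x * hermite₁ a l x * |x| ^ (2 * a + 1) =
      if k = l then 1 / 2 else 0 := by
  obtain ⟨e, n, m, rfl, rfl⟩ : ∃ (e : Fin 2) (n m : ℕ), k = 2 * n + e ∧ l = 2 * m + e :=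
    ⟨⟨k % 2, Nat.mod_lt _ two_pos⟩, k / 2, l / 2, by simp only; omega, by simp only; omega⟩
  set c := a + (e : ℕ) + 1 with hcdef
  have hc : 0 < c := by
    have : (0 : ℝ) ≤ ((e : ℕ) : ℝ) := Nat.cast_nonneg _
    linarith
  have e1 : ∀ x ∈ Ioi (0 : ℝ),
      hermite₁ a (2 * n + e) x * hermite₁ a (2 * m + e) x * |x| ^ (2 * a + 1) =
      ((-1) ^ n * √(Real.Gamma (n + c) / n.factorial) *
        ((-1) ^ m * √(Real.Gamma (m + c) / m.factorial))) *
      (laguerreN c n (x ^ 2) * laguerreN c m (x ^ 2) *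
        (x ^ (2 * c - 1) * Real.exp (-x ^ 2))) := by
    intro x hx
    have hx : (0 : ℝ) < x := hx
    have e2 : Real.exp (-x ^ 2) = Real.exp (-x ^ 2 / 2) * Real.exp (-x ^ 2 / 2) := by
      rw [← Real.exp_add]
      congr 1
      ring
    have e3 : x ^ (2 * c - 1) = x ^ (e : ℕ) * x ^ (e : ℕ) * x ^ (2 * a + 1) := by
      rw [← Real.rpow_natCast, ← Real.rpow_add hx, ← Real.rpow_add hx, hcdef]
      congr 1
      ring
    rw [hermite₁_two_mul_add ha, hermite₁_two_mul_add ha, abs_of_pos hx, e2, e3, ← hcdef]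
    ring
  rw [setIntegral_congr_fun measurableSet_Ioi e1, integral_const_mul, integral_laguerreN hc]
  by_cases hnm : n = m
  · subst hnm
    have hG := Gamma_natCast_add_pos hc n
    have e3 : √(Real.Gamma (n + c) / n.factorial) * √(Real.Gamma (n + c) / n.factorial) =
        Real.Gamma (n + c) / n.factorial :=
      Real.mul_self_sqrt (by positivity)
    have e4 : ((-1 : ℝ) ^ n) * (-1) ^ n = 1 := by
      rw [← mul_pow]
      simp
    rw [if_pos rfl, if_pos rfl, mul_mul_mul_comm, e3, e4]
    have : (n.factorial : ℝ) ≠ 0 := by positivity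
    field_simp
  · rw [if_neg hnm, if_neg (by omega), mul_zero]

lemma restrict_orthant_eq_pi (d : ℕ) : (volume.restrict (orthant d : Set (Fin d → ℝ))) =
    Measure.pi fun _ : Fin d => (volume : Measure ℝ).restrict (Ioi 0) := by
  rw [volume_pi]
  exact Measure.restrict_pi_pi _ _

lemma integral_hermite_mul {d : ℕ} {α : Fin d → ℝ} (hα : ∀ i, -1 / 2 ≤ α i) {k l : Fin d → ℕ}
    (h : ∀ i, k i % 2 = l i % 2) :
    ∫ x, hermite α k x * hermite α l x ∂(wPlus α) = if k = l then (1 / 2) ^ d else 0 := by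
  rw [wPlus, integral_withDensity_eq_integral_toReal_smul (by fun_prop) (by simp),
    restrict_orthant_eq_pi]
  have e : ∀ x : Fin d → ℝ, (ENNReal.ofReal (∏ i, |x i| ^ (2 * α i + 1))).toReal •
      (hermite α k x * hermite α l x) =
      ∏ i, hermite₁ (α i) (k i) (x i) * hermite₁ (α i) (l i) (x i) *
        |x i| ^ (2 * α i + 1) := by
    intro x
    rw [ENNReal.toReal_ofReal (Finset.prod_nonneg fun i _ => by positivity),
      Finset.prod_mul_distrib, Finset.prod_mul_distrib, smul_eq_mul, mul_comm]
    rfl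
  simp only [e]
  rw [integral_fintype_prod_eq_prod (𝕜 := ℝ) fun i s =>
    hermite₁ (α i) (k i) s * hermite₁ (α i) (l i) s * |s| ^ (2 * α i + 1)]
  simp only [integral_hermite₁_mul (hα _) (h _)]
  rw [prod_ite_eq_ite_forall]
  simp [funext_iff]

lemma inner_hermiteL2 {d : ℕ} {α : Fin d → ℝ} (hα : ∀ i, -1 / 2 ≤ α i) {k l : Fin d → ℕ}
    (h : ∀ i, k i % 2 = l i % 2) :
    inner ℂ (hermiteL2 α hα k) (hermiteL2 α hα l) = if k = l then ((1 / 2 : ℝ) ^ d : ℂ) else 0 := by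
  have e : (∫ x, inner ℂ (hermiteL2 α hα k x) (hermiteL2 α hα l x) ∂(wPlus α)) =
      ∫ x, ((hermite α k x * hermite α l x : ℝ) : ℂ) ∂(wPlus α) := by
    refine integral_congr_ae ?_
    filter_upwards [(memLp_hermite α hα k).coeFn_toLp, (memLp_hermite α hα l).coeFn_toLp]
      with x hk hl
    rw [hermiteL2, hermiteL2, hk, hl]
    simp [mul_comm]
  rw [L2.inner_def, e, integral_complex_ofReal, integral_hermite_mul hα h]
  split_ifs <;> simp

/-- The multi-indices whose parities are prescribed by `ε`. -/
abbrev ParityIndex {d : ℕ} (ε : Fin d → Fin 2) : Type :=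
  {k : Fin d → ℕ // ∀ i, k i % 2 = (ε i : ℕ)}

lemma orthonormal_hermiteL2 {d : ℕ} {α : Fin d → ℝ} (hα : ∀ i, -1 / 2 ≤ α i)
    (ε : Fin d → Fin 2) :
    Orthonormal ℂ fun k : ParityIndex ε => ((√2 ^ d : ℝ) : ℂ) • hermiteL2 α hα k.1 := by
  classical
  rw [orthonormal_iff_ite]
  intro k l
  rw [inner_smul_left, inner_smul_right, inner_hermiteL2 hα fun i => by rw [k.2 i, l.2 i],
    Complex.conj_ofReal]
  by_cases h : k = l
  · rw [if_pos h, if_pos (congrArg _ h)]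
    rw [← mul_assoc, ← Complex.ofReal_mul, ← mul_pow, Real.mul_self_sqrt zero_le_two]
    push_cast
    rw [← mul_pow]
    norm_num
  · rw [if_neg h, if_neg fun h' => h (Subtype.ext h'), mul_zero, mul_zero]

/-- Bessel's inequality for the generalized Hermite functions of parity `ε`. -/
lemma summable_sq_inner_hermiteL2 {d : ℕ} {α : Fin d → ℝ} (hα : ∀ i, -1 / 2 ≤ α i)
    (ε : Fin d → Fin 2) (u : L2Plus α) :
    Summable fun k : ParityIndex ε => ‖inner ℂ (hermiteL2 α hα k.1) u‖ ^ 2 := by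
  have h := ((orthonormal_hermiteL2 hα ε).inner_products_summable u).mul_left ((2 : ℝ) ^ d)⁻¹
  refine h.congr fun k => ?_
  rw [inner_smul_left, norm_mul, RCLike.norm_conj, Complex.norm_real, mul_pow,
    Real.norm_of_nonneg (by positivity), ← pow_mul, mul_comm d 2, pow_mul, Real.sq_sqrt zero_le_two]
  field_simp

lemma hasSum_parityIndex {d : ℕ} {E : Type*} [AddCommMonoid E] [TopologicalSpace E]
    {ε : Fin d → Fin 2} {f : (Fin d → ℕ) → E} {a : E} :
    HasSum (fun k : ParityIndex ε => f k.1) a ↔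
      HasSum (fun k : Fin d → ℕ => if ∀ i, k i % 2 = (ε i : ℕ) then f k else 0) a := by
  rw [← hasSum_subtype_iff_of_support_subset (s := {k : Fin d → ℕ | ∀ i, k i % 2 = (ε i : ℕ)})]
  · refine iff_of_eq (congrArg (HasSum · a) (funext fun k => ?_))
    rw [Function.comp_apply, if_pos k.2]
  · intro k hk
    by_contra hn
    exact hk (if_neg hn)

/-- Reindexing from all multi-indices of parity `ε` to the shells of constant length. -/
lemma hasSum_shell {d : ℕ} {E : Type*} [NormedAddCommGroup E] [CompleteSpace E]
    {ε : Fin d → Fin 2} {g : (Fin d → ℕ) → E} {a : E}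
    (h : HasSum (fun k : ParityIndex ε => g k.1) a) :
    HasSum (fun n => ∑ k ∈ shell ε n, g k) a := by
  refine hasSum_of_eq ((hasSum_parityIndex.1 h).tsum_fiberwise fun k => ∑ i, k i) (fun n => ?_) rfl
  have hset : ((fun k : Fin d → ℕ => ∑ i, k i) ⁻¹' {n}) =
      ((Finset.piAntidiag Finset.univ n : Finset (Fin d → ℕ)) : Set (Fin d → ℕ)) := by
    ext k
    simp
  rw [hset, Finset.tsum_subtype' _ fun k => if ∀ i, k i % 2 = (ε i : ℕ) then g k else 0, shell,
    Finset.sum_filter]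

/-- Square summability of the coefficients implies unconditional convergence, by orthogonality. -/
lemma summable_smul_hermiteL2 {d : ℕ} {α : Fin d → ℝ} (hα : ∀ i, -1 / 2 ≤ α i)
    (ε : Fin d → Fin 2) {b : ParityIndex ε → ℂ} (hb : Summable fun k => ‖b k‖ ^ 2) :
    Summable fun k : ParityIndex ε => b k • hermiteL2 α hα k.1 := by
  have ho := orthonormal_hermiteL2 hα ε
  have hs : ((√2 ^ d : ℝ) : ℂ) ≠ 0 := by
    rw [Complex.ofReal_ne_zero]
    positivity
  have h := (ho.orthogonalFamily.summable_iff_norm_sq_summable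
    fun k => (((√2 ^ d : ℝ) : ℂ)⁻¹ * b k)).2 (by
      simp only [norm_mul, mul_pow]
      exact hb.mul_left _)
  refine h.congr fun k => ?_
  rw [LinearIsometry.toSpanSingleton_apply, smul_smul]
  congr 1
  field_simp

/-- The multi-indexed form of the series defining a bounded multiplier operator. -/
lemma summable_multiplier {d : ℕ} {α : Fin d → ℝ} (hα : ∀ i, -1 / 2 ≤ α i) (ε : Fin d → Fin 2)
    {m : ℝ → ℂ} {M : ℝ} (hm : ∀ n, ‖m (eigenvalue α n)‖ ≤ M) (u : L2Plus α) :
    Summable fun k : ParityIndex ε => m (eigenvalue α (∑ i, k.1 i)) •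
      (inner ℂ (hermiteL2 α hα k.1) u • hermiteL2 α hα k.1) := by
  simp only [smul_smul]
  refine summable_smul_hermiteL2 hα ε ?_
  refine .of_nonneg_of_le (fun k => by positivity) (fun k => ?_)
    ((summable_sq_inner_hermiteL2 hα ε u).mul_left (M ^ 2))
  rw [norm_mul, mul_pow]
  gcongr
  exact hm _

lemma hasSum_multiplierTerm {d : ℕ} {α : Fin d → ℝ} (hα : ∀ i, -1 / 2 ≤ α i) (ε : Fin d → Fin 2)
    {m : ℝ → ℂ} {M : ℝ} (hm : ∀ n, ‖m (eigenvalue α n)‖ ≤ M) (u : L2Plus α) :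
    HasSum (multiplierTerm α hα ε m u) (∑' k : ParityIndex ε, m (eigenvalue α (∑ i, k.1 i)) •
      (inner ℂ (hermiteL2 α hα k.1) u • hermiteL2 α hα k.1)) := by
  refine hasSum_of_eq (hasSum_shell (g := fun k => m (eigenvalue α (∑ i, k i)) •
    (inner ℂ (hermiteL2 α hα k) u • hermiteL2 α hα k)) (summable_multiplier hα ε hm u).hasSum)
    (fun n => ?_) rfl
  rw [multiplierTerm, Finset.smul_sum]
  refine Finset.sum_congr rfl fun k hk => ?_
  have : ∑ i, k i = n := by
    have := (Finset.mem_filter.1 hk).1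
    simpa using this
  rw [this]

lemma summable_multiplierTerm {d : ℕ} {α : Fin d → ℝ} (hα : ∀ i, -1 / 2 ≤ α i)
    (ε : Fin d → Fin 2) {m : ℝ → ℂ} {M : ℝ} (hm : ∀ n, ‖m (eigenvalue α n)‖ ≤ M)
    (u : L2Plus α) : Summable (multiplierTerm α hα ε m u) :=
  (hasSum_multiplierTerm hα ε hm u).summable

lemma hasSum_inner_multiplierOp {d : ℕ} {α : Fin d → ℝ} (hα : ∀ i, -1 / 2 ≤ α i)
    (ε : Fin d → Fin 2) {m : ℝ → ℂ} {M : ℝ} (hm : ∀ n, ‖m (eigenvalue α n)‖ ≤ M)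
    (u v : L2Plus α) :
    HasSum (fun k : ParityIndex ε => m (eigenvalue α (∑ i, k.1 i)) *
        (inner ℂ (hermiteL2 α hα k.1) u * inner ℂ v (hermiteL2 α hα k.1)))
      (inner ℂ v (multiplierOp α hα ε m u)) := by
  rw [multiplierOp, (hasSum_multiplierTerm hα ε hm u).tsum_eq]
  refine hasSum_of_eq ((innerSL ℂ v).hasSum (summable_multiplier hα ε hm u).hasSum)
    (fun k => ?_) rfl
  simp

lemma summable_inner_mul_inner {d : ℕ} {α : Fin d → ℝ} (hα : ∀ i, -1 / 2 ≤ α i)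
    (ε : Fin d → Fin 2) (u v : L2Plus α) :
    Summable fun k : ParityIndex ε =>
      ‖inner ℂ (hermiteL2 α hα k.1) u * inner ℂ v (hermiteL2 α hα k.1)‖ := by
  refine .of_nonneg_of_le (fun k => norm_nonneg _) (fun k => ?_)
    ((summable_sq_inner_hermiteL2 hα ε u).add (summable_sq_inner_hermiteL2 hα ε v))
  rw [norm_mul, norm_inner_symm v]
  nlinarith [sq_nonneg (‖inner ℂ (hermiteL2 α hα k.1) u‖ - ‖inner ℂ (hermiteL2 α hα k.1) v‖),
    sq_nonneg ‖inner ℂ (hermiteL2 α hα k.1) u‖, sq_nonneg ‖inner ℂ (hermiteL2 α hα k.1) v‖]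

/-! ### Size and regularity of the heat kernel -/

lemma hasDerivAt_besselSeries {c : ℝ} (hc : 0 < c) (w : ℝ) :
    HasDerivAt (besselSeries c) (besselSeries (c + 1) w) w := by
  have hc1 : 0 < c + 1 := by linarith
  have hshift : ∀ (y : ℝ) (j : ℕ),
      ((j + 1 : ℕ) : ℝ) * y ^ j / ((j + 1).factorial * Real.Gamma ((j + 1 : ℕ) + c)) =
      y ^ j / (j.factorial * Real.Gamma (j + (c + 1))) := by
    intro y j
    have : ((j + 1 : ℕ) : ℝ) + c = j + (c + 1) := by push_cast; ring
    rw [this, Nat.factorial_succ]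
    have := (Gamma_natCast_add_pos hc1 j).ne'
    push_cast
    field_simp
  set R := |w| + 1
  have hw : w ∈ Metric.ball (0 : ℝ) R := by
    rw [mem_ball_zero_iff, Real.norm_eq_abs]
    linarith
  have hsum : ∀ y : ℝ, Summable fun j : ℕ =>
      (j : ℝ) * y ^ (j - 1) / (j.factorial * Real.Gamma (j + c)) := by
    intro y
    rw [← summable_nat_add_iff 1]
    simp only [Nat.add_sub_cancel, hshift]
    exact summable_besselSeries hc1 y
  have h := hasDerivAt_tsum_of_isPreconnected (𝕜 := ℝ) (F := ℝ)
    (g := fun (j : ℕ) y => y ^ j / (j.factorial * Real.Gamma (j + c)))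
    (g' := fun (j : ℕ) y => (j : ℝ) * y ^ (j - 1) / (j.factorial * Real.Gamma (j + c)))
    (hsum R) Metric.isOpen_ball (convex_ball (0 : ℝ) R).isPreconnected
    (fun j y _ => (hasDerivAt_pow j y).div_const _)
    (fun j y hy => by
      have hG := Gamma_natCast_add_pos hc j
      rw [mem_ball_zero_iff] at hy
      rw [norm_div, norm_mul, norm_pow, Real.norm_of_nonneg (Nat.cast_nonneg j),
        Real.norm_of_nonneg (by positivity : 0 ≤ j.factorial * Real.Gamma (j + c))]
      gcongr)
    hw (summable_besselSeries hc w) hw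
  have e : ∑' j : ℕ, (j : ℝ) * w ^ (j - 1) / (j.factorial * Real.Gamma (j + c)) =
      besselSeries (c + 1) w := by
    rw [(hsum w).tsum_eq_zero_add, besselSeries]
    simp only [Nat.add_sub_cancel, hshift]
    simp
  rw [e] at h
  exact h

lemma continuous_besselSeries {c : ℝ} (hc : 0 < c) : Continuous (besselSeries c) :=
  continuous_iff_continuousAt.2 fun w => (hasDerivAt_besselSeries hc w).continuousAt

lemma besselSeries_nonneg {c : ℝ} (hc : 0 < c) {w : ℝ} (hw : 0 ≤ w) : 0 ≤ besselSeries c w :=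
  tsum_nonneg fun j => by
    have := Gamma_natCast_add_pos hc j
    positivity

/-- The upper bound `z^{-ν} I_ν(z) ≲ e^z` for `ν = c - 1 ≥ -1/2`; for `c = 1/2` the series is that
of `cosh z`. -/
lemma besselSeries_le {c : ℝ} (hc : 1 / 2 ≤ c) {z : ℝ} (hz : 0 ≤ z) :
    besselSeries c ((z / 2) ^ 2) ≤ (Real.Gamma c)⁻¹ * Real.exp z := by
  have hc0 : 0 < c := by linarith
  have hG := Real.Gamma_pos_of_pos hc0
  have hfac : ∀ j : ℕ, Real.Gamma c * (2 * j).factorial ≤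
      4 ^ j * (j.factorial * Real.Gamma (j + c)) := by
    intro j
    induction j with
    | zero => simp
    | succ j ih =>
      rw [Gamma_natCast_succ_add hc0, show 2 * (j + 1) = 2 * j + 1 + 1 by ring,
        Nat.factorial_succ, Nat.factorial_succ, Nat.factorial_succ]
      push_cast
      have h1 : (2 * (j : ℝ) + 1 + 1) * (2 * j + 1) ≤ 4 * ((j + 1) * (j + c)) := by
        have : (0 : ℝ) ≤ j := j.cast_nonneg
        nlinarith
      calc Real.Gamma c * ((2 * (j : ℝ) + 1 + 1) * ((2 * j + 1) * (2 * j).factorial))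
          = ((2 * (j : ℝ) + 1 + 1) * (2 * j + 1)) * (Real.Gamma c * (2 * j).factorial) := by ring
        _ ≤ (4 * ((j + 1) * (j + c))) *
            (4 ^ j * (j.factorial * Real.Gamma (j + c))) := by gcongr
        _ = _ := by ring
  calc besselSeries c ((z / 2) ^ 2) ≤ (Real.Gamma c)⁻¹ * Real.cosh z := by
        refine hasSum_le (fun j => ?_) (hasSum_besselSeries hc0 _)
          ((Real.hasSum_cosh z).mul_left (Real.Gamma c)⁻¹)
        have h1 := hfac j
        have h2 := Gamma_natCast_add_pos hc0 j
        have e : ((z / 2) ^ 2) ^ j = z ^ (2 * j) / 4 ^ j := by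
          rw [div_pow, div_pow, ← pow_mul]
          norm_num
        rw [e, div_div, inv_mul_eq_div, div_div]
        exact div_le_div_of_nonneg_left (by positivity) (by positivity)
          (by rw [mul_comm]; exact h1)
    _ ≤ _ := by
        gcongr
        rw [Real.cosh_eq]
        have := Real.exp_le_exp.2 (by linarith : -z ≤ z)
        linarith

/-- The `t`-derivative of `heatKernel₁`. -/
noncomputable def heatKernelDeriv₁ (c : ℝ) (e : ℕ) (t x y : ℝ) : ℝ :=
  (x * y) ^ e * (2 * Real.sinh (2 * t)) ^ (-c) *
    Real.exp (-(1 / 2) * (Real.cosh (2 * t) / Real.sinh (2 * t)) * (x ^ 2 + y ^ 2)) *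
    ((-2 * c * (Real.cosh (2 * t) / Real.sinh (2 * t)) +
        (x ^ 2 + y ^ 2) / Real.sinh (2 * t) ^ 2) *
      besselSeries c ((x * y / (2 * Real.sinh (2 * t))) ^ 2) -
    (x * y) ^ 2 * (Real.cosh (2 * t) / Real.sinh (2 * t)) / Real.sinh (2 * t) ^ 2 *
      besselSeries (c + 1) ((x * y / (2 * Real.sinh (2 * t))) ^ 2))

lemma hasDerivAt_heatKernel₁ {c : ℝ} (hc : 0 < c) (e : ℕ) {t : ℝ} (ht : 0 < t) (x y : ℝ) :
    HasDerivAt (fun s => heatKernel₁ c e s x y) (heatKernelDeriv₁ c e t x y) t := by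
  have hs := sinh_two_mul_pos ht
  have hs' : (2 * Real.sinh (2 * t)) ≠ 0 := by positivity
  have h2 : HasDerivAt (fun s : ℝ => 2 * s) 2 t := by
    simpa using (hasDerivAt_id t).const_mul 2
  have dS : HasDerivAt (fun s => Real.sinh (2 * s)) (Real.cosh (2 * t) * 2) t := h2.sinh
  have dC : HasDerivAt (fun s => Real.cosh (2 * s)) (Real.sinh (2 * t) * 2) t := h2.cosh
  have d1 := (dS.const_mul 2).rpow_const (p := -c) (Or.inl hs')
  have d2 := (((dC.div dS hs.ne').const_mul (-(1 / 2))).mul_const (x ^ 2 + y ^ 2)).exp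
  have d3 := (((hasDerivAt_const t (x * y)).div (dS.const_mul 2) hs').pow 2)
  have d4 := (hasDerivAt_besselSeries hc _).comp t d3
  have d := ((d1.const_mul ((x * y) ^ e)).mul d2).mul d4
  refine d.congr_deriv ?_
  have e1 : (2 * Real.sinh (2 * t)) ^ (-c - 1) =
      (2 * Real.sinh (2 * t)) ^ (-c) / (2 * Real.sinh (2 * t)) := by
    rw [Real.rpow_sub_one hs']
  have e2 := Real.cosh_sq (2 * t)
  simp only [heatKernelDeriv₁, Pi.div_apply, Pi.mul_apply, Pi.pow_apply, Function.comp_apply, e1,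
    Nat.add_one_sub_one, pow_one, Nat.cast_ofNat]
  set S := Real.sinh (2 * t)
  set C := Real.cosh (2 * t)
  set P := (2 * S) ^ (-c)
  set X := Real.exp (-(1 / 2) * (C / S) * (x ^ 2 + y ^ 2))
  set B := besselSeries c ((x * y / (2 * S)) ^ 2)
  set B' := besselSeries (c + 1) ((x * y / (2 * S)) ^ 2)
  field_simp
  rw [e2]
  ring

lemma cosh_div_sinh_le {t : ℝ} (ht : 0 < t) :
    Real.cosh (2 * t) / Real.sinh (2 * t) ≤ 1 + (Real.sinh (2 * t))⁻¹ := by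
  have hs := sinh_two_mul_pos ht
  have h : Real.cosh (2 * t) - Real.sinh (2 * t) ≤ 1 := by
    rw [Real.cosh_sub_sinh, Real.exp_le_one_iff]
    linarith
  rw [div_le_iff₀ hs, add_mul, inv_mul_cancel₀ hs.ne']
  linarith

/-- The Gaussian factor of the heat kernel absorbs the exponential growth of the Bessel factor. -/
lemma exp_mul_besselSeries_le {c : ℝ} (hc : 1 / 2 ≤ c) {t : ℝ} (ht : 0 < t) {x y : ℝ}
    (hx : 0 < x) (hy : 0 < y) :
    Real.exp (-(1 / 2) * (Real.cosh (2 * t) / Real.sinh (2 * t)) * (x ^ 2 + y ^ 2)) *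
      besselSeries c ((x * y / (2 * Real.sinh (2 * t))) ^ 2) ≤
    (Real.Gamma c)⁻¹ * Real.exp (-((x - y) ^ 2 / 2) * (Real.sinh (2 * t))⁻¹) := by
  have hs := sinh_two_mul_pos ht
  have e : x * y / (2 * Real.sinh (2 * t)) = (x * y / Real.sinh (2 * t)) / 2 := by
    field_simp
  have h := besselSeries_le hc (z := x * y / Real.sinh (2 * t)) (by positivity)
  have hG := Real.Gamma_pos_of_pos (by linarith : 0 < c)
  rw [e]
  calc _ ≤ Real.exp (-(1 / 2) * (Real.cosh (2 * t) / Real.sinh (2 * t)) * (x ^ 2 + y ^ 2)) *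
        ((Real.Gamma c)⁻¹ * Real.exp (x * y / Real.sinh (2 * t))) := by gcongr
    _ = (Real.Gamma c)⁻¹ *
        Real.exp (-(1 / 2) * (Real.cosh (2 * t) / Real.sinh (2 * t)) * (x ^ 2 + y ^ 2) +
          x * y / Real.sinh (2 * t)) := by
        rw [Real.exp_add]
        ring
    _ ≤ _ := by
        gcongr
        have h1 : (Real.sinh (2 * t))⁻¹ ≤ Real.cosh (2 * t) / Real.sinh (2 * t) := by
          rw [inv_eq_one_div]
          gcongr
          exact Real.one_le_cosh _
        have h2 := mul_le_mul_of_nonneg_right h1 (by positivity : 0 ≤ (x ^ 2 + y ^ 2) / 2)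
        have h3 : x * y / Real.sinh (2 * t) = x * y * (Real.sinh (2 * t))⁻¹ := div_eq_mul_inv _ _
        rw [h3]
        linarith

lemma rpow_neg_two_mul_le {c s : ℝ} (hc : 0 ≤ c) (hs : 0 < s) :
    (2 * s) ^ (-c) ≤ s⁻¹ ^ c := by
  rw [Real.inv_rpow hs.le, ← Real.rpow_neg hs.le]
  exact Real.rpow_le_rpow_of_nonpos hs (by linarith) (by linarith)

lemma heatKernel₁_nonneg {c : ℝ} (hc : 0 < c) (e : ℕ) {t : ℝ} (ht : 0 < t) {x y : ℝ}
    (hx : 0 < x) (hy : 0 < y) : 0 ≤ heatKernel₁ c e t x y := by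
  have hs := sinh_two_mul_pos ht
  have := besselSeries_nonneg hc (sq_nonneg (x * y / (2 * Real.sinh (2 * t))))
  unfold heatKernel₁
  positivity

/-- A common bound of `heatKernel₁` and its derivative, in terms of `v = 1 / sinh 2t`. -/
lemma heatKernel₁_bounds {c : ℝ} (hc : 1 / 2 ≤ c) (e : ℕ) {R : ℝ} (hR : 0 ≤ R) :
    ∃ A : ℝ, 0 ≤ A ∧ ∀ t x y : ℝ, 0 < t → 0 < x → 0 < y → x ≤ R → y ≤ R →
      |heatKernel₁ c e t x y| ≤ A * ((1 + (Real.sinh (2 * t))⁻¹) ^ 3 *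
        (Real.sinh (2 * t))⁻¹ ^ c * Real.exp (-((x - y) ^ 2 / 2) * (Real.sinh (2 * t))⁻¹)) ∧
      |heatKernelDeriv₁ c e t x y| ≤ A * ((1 + (Real.sinh (2 * t))⁻¹) ^ 3 *
        (Real.sinh (2 * t))⁻¹ ^ c * Real.exp (-((x - y) ^ 2 / 2) * (Real.sinh (2 * t))⁻¹)) := by
  have hc0 : 0 < c := by linarith
  have hG := Real.Gamma_pos_of_pos hc0
  have hG1 := Real.Gamma_pos_of_pos (by linarith : 0 < c + 1)
  set A₀ := (R * R) ^ e * (Real.Gamma c)⁻¹ with hA₀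
  set A₁ := (R * R) ^ e * ((2 * c + 2 * (R * R)) * (Real.Gamma c)⁻¹ +
    (R * R) ^ 2 * (Real.Gamma (c + 1))⁻¹) with hA₁
  have hA₀0 : 0 ≤ A₀ := by positivity
  have hA₁0 : 0 ≤ A₁ := by positivity
  refine ⟨A₀ + A₁, by positivity, fun t x y ht hx hy hxR hyR => ?_⟩
  have hs := sinh_two_mul_pos ht
  have hcoth := cosh_div_sinh_le ht
  have hB := exp_mul_besselSeries_le hc ht hx hy
  have hB1 := exp_mul_besselSeries_le (by linarith : 1 / 2 ≤ c + 1) ht hx hy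
  have hpow := rpow_neg_two_mul_le hc0.le hs
  have hb0 := besselSeries_nonneg hc0 (sq_nonneg (x * y / (2 * Real.sinh (2 * t))))
  have hb1 := besselSeries_nonneg (by linarith : 0 < c + 1)
    (sq_nonneg (x * y / (2 * Real.sinh (2 * t))))
  have hcoth0 : 0 ≤ Real.cosh (2 * t) / Real.sinh (2 * t) := by
    have := Real.cosh_pos (2 * t)
    positivity
  set S := Real.sinh (2 * t)
  set Q := Real.cosh (2 * t) / S
  set X := Real.exp (-(1 / 2) * Q * (x ^ 2 + y ^ 2)) with hX
  have hX0 : 0 < X := Real.exp_pos _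
  set B := besselSeries c ((x * y / (2 * S)) ^ 2)
  set B' := besselSeries (c + 1) ((x * y / (2 * S)) ^ 2)
  set Y := Real.exp (-((x - y) ^ 2 / 2) * S⁻¹)
  have hY0 : 0 < Y := Real.exp_pos _
  set v := S⁻¹ with hv
  have hv0 : 0 < v := inv_pos.2 hs
  have hxy : x * y ≤ R * R := mul_le_mul hxR hyR hy.le hR
  have hpw : 0 < (2 * S) ^ (-c) := Real.rpow_pos_of_pos (by positivity) _
  have hvc : 0 < v ^ c := Real.rpow_pos_of_pos hv0 _
  have h3 : 1 ≤ (1 + v) ^ 3 := one_le_pow₀ (by linarith)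
  constructor
  · rw [abs_of_nonneg (heatKernel₁_nonneg hc0 e ht hx hy)]
    calc heatKernel₁ c e t x y = (x * y) ^ e * (2 * S) ^ (-c) * (X * B) := by
          rw [heatKernel₁]
          ring
      _ ≤ (R * R) ^ e * v ^ c * ((Real.Gamma c)⁻¹ * Y) := by gcongr
      _ = A₀ * (1 * v ^ c * Y) := by rw [hA₀]; ring
      _ ≤ (A₀ + A₁) * ((1 + v) ^ 3 * v ^ c * Y) := by
          gcongr
          linarith
  · have hsq : x ^ 2 + y ^ 2 ≤ 2 * (R * R) := by nlinarith
    have e1 : heatKernelDeriv₁ c e t x y = (x * y) ^ e * (2 * S) ^ (-c) *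
        ((-2 * c * Q + (x ^ 2 + y ^ 2) * v ^ 2) * (X * B) -
          (x * y) ^ 2 * Q * v ^ 2 * (X * B')) := by
      rw [heatKernelDeriv₁, hv, inv_pow]
      ring
    have e2 : |(-2 * c * Q + (x ^ 2 + y ^ 2) * v ^ 2) * (X * B) -
          (x * y) ^ 2 * Q * v ^ 2 * (X * B')| ≤
        (2 * c * Q + (x ^ 2 + y ^ 2) * v ^ 2) * (X * B) +
          (x * y) ^ 2 * Q * v ^ 2 * (X * B') := by
      have p1 : 0 ≤ 2 * c * Q * (X * B) := by positivity
      have p2 : 0 ≤ (x ^ 2 + y ^ 2) * v ^ 2 * (X * B) := by positivity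
      have p3 : 0 ≤ (x * y) ^ 2 * Q * v ^ 2 * (X * B') := by positivity
      rw [abs_le]
      constructor <;> linarith
    have hq1 : Q ≤ (1 + v) ^ 3 := hcoth.trans (le_self_pow₀ (by linarith) (by norm_num))
    have hv2 : v ^ 2 ≤ (1 + v) ^ 3 := by nlinarith [pow_pos hv0 2, pow_pos hv0 3]
    have hq2 : Q * v ^ 2 ≤ (1 + v) ^ 3 := by
      calc Q * v ^ 2 ≤ (1 + v) * (1 + v) ^ 2 := by gcongr; linarith
        _ = _ := by ring
    rw [e1, abs_mul, abs_of_nonneg (by positivity : 0 ≤ (x * y) ^ e * (2 * S) ^ (-c))]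
    calc _ ≤ (x * y) ^ e * (2 * S) ^ (-c) * ((2 * c * Q + (x ^ 2 + y ^ 2) * v ^ 2) * (X * B) +
          (x * y) ^ 2 * (Q * v ^ 2) * (X * B')) := by
          rw [← mul_assoc ((x * y) ^ 2) Q]
          gcongr
      _ ≤ (R * R) ^ e * v ^ c * ((2 * c * (1 + v) ^ 3 + (2 * (R * R)) * (1 + v) ^ 3) *
          ((Real.Gamma c)⁻¹ * Y) +
          (R * R) ^ 2 * (1 + v) ^ 3 * ((Real.Gamma (c + 1))⁻¹ * Y)) := by gcongr
      _ = A₁ * ((1 + v) ^ 3 * v ^ c * Y) := by rw [hA₁]; ring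
      _ ≤ (A₀ + A₁) * ((1 + v) ^ 3 * v ^ c * Y) := by
          gcongr
          linarith

lemma exists_pow_mul_exp_le (N : ℕ) {δ : ℝ} (hδ : 0 < δ) :
    ∃ C : ℝ, 0 ≤ C ∧ ∀ v : ℝ, 0 ≤ v → (2 + v) ^ N * Real.exp (-(δ / 2) * v) ≤ C := by
  refine ⟨N.factorial * (2 / δ) ^ N * Real.exp δ, by positivity, fun v hv => ?_⟩
  have h := Real.pow_div_factorial_le_exp (δ / 2 * (2 + v)) (by positivity) N
  rw [div_le_iff₀ (by positivity)] at h
  have e : (2 + v) ^ N = (2 / δ) ^ N * (δ / 2 * (2 + v)) ^ N := by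
    rw [← mul_pow]
    congr 1
    field_simp
  rw [e]
  calc _ ≤ (2 / δ) ^ N * (Real.exp (δ / 2 * (2 + v)) * N.factorial) *
        Real.exp (-(δ / 2) * v) := by gcongr
    _ = N.factorial * (2 / δ) ^ N *
        (Real.exp (δ / 2 * (2 + v)) * Real.exp (-(δ / 2) * v)) := by ring
    _ = _ := by
        rw [← Real.exp_add]
        congr 2
        ring

/-- The `t`-derivative of the component heat kernel. -/
noncomputable def heatKernelDeriv {d : ℕ} (α : Fin d → ℝ) (ε : Fin d → Fin 2) (t : ℝ)
    (x y : Fin d → ℝ) : ℝ :=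
  ∑ i, (∏ j ∈ Finset.univ.erase i,
    heatKernel₁ (α j + (ε j : ℕ) + 1) (ε j : ℕ) t (x j) (y j)) *
      heatKernelDeriv₁ (α i + (ε i : ℕ) + 1) (ε i : ℕ) t (x i) (y i)

lemma half_le_order {d : ℕ} {α : Fin d → ℝ} (hα : ∀ i, -1 / 2 ≤ α i) (ε : Fin d → Fin 2)
    (i : Fin d) : 1 / 2 ≤ α i + (ε i : ℕ) + 1 := by
  have : (0 : ℝ) ≤ ((ε i : ℕ) : ℝ) := Nat.cast_nonneg _
  linarith [hα i]

lemma order_pos {d : ℕ} {α : Fin d → ℝ} (hα : ∀ i, -1 / 2 ≤ α i) (ε : Fin d → Fin 2)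
    (i : Fin d) : 0 < α i + (ε i : ℕ) + 1 :=
  one_half_pos.trans_le (half_le_order hα ε i)

lemma hasDerivAt_heatKernel {d : ℕ} {α : Fin d → ℝ} (hα : ∀ i, -1 / 2 ≤ α i)
    (ε : Fin d → Fin 2) {t : ℝ} (ht : 0 < t) {x y : Fin d → ℝ} (hx : x ∈ orthant d)
    (hy : y ∈ orthant d) :
    HasDerivAt (fun s => heatKernel α ε s x y) (heatKernelDeriv α ε t x y) t := by
  have h := HasDerivAt.fun_finsetProd (u := Finset.univ) (x := t)
    (f := fun i s => heatKernel₁ (α i + (ε i : ℕ) + 1) (ε i : ℕ) s (x i) (y i))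
    (f' := fun i => heatKernelDeriv₁ (α i + (ε i : ℕ) + 1) (ε i : ℕ) t (x i) (y i))
    fun i _ => hasDerivAt_heatKernel₁ (order_pos hα ε i) _ ht _ _
  refine HasDerivAt.congr_of_eventuallyEq h ?_
  filter_upwards [lt_mem_nhds ht] with s hs
  exact heatKernel_eq_prod α ε hs hx hy

/-- Off the diagonal, locally uniformly, both the heat kernel and its time derivative are bounded by
a multiple of `e^{-λ_0 t}` for all `t > 0`. -/
lemma heatKernel_bounds {d : ℕ} {α : Fin d → ℝ} (hα : ∀ i, -1 / 2 ≤ α i) (ε : Fin d → Fin 2)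
    {R δ : ℝ} (hR : 0 ≤ R) (hδ : 0 < δ) :
    ∃ C : ℝ, 0 ≤ C ∧ ∀ (t : ℝ) (x y : Fin d → ℝ), 0 < t → x ∈ orthant d → y ∈ orthant d →
      (∀ i, x i ≤ R) → (∀ i, y i ≤ R) → δ ≤ ∑ i, (x i - y i) ^ 2 →
      |heatKernel α ε t x y| ≤ C * Real.exp (-t * eigenvalue α 0) ∧
      |heatKernelDeriv α ε t x y| ≤ C * Real.exp (-t * eigenvalue α 0) := by
  choose A hA0 hA using fun i => heatKernel₁_bounds (half_le_order hα ε i) (ε i : ℕ) hR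
  set c : Fin d → ℝ := fun i => α i + (ε i : ℕ) + 1 with hc
  have hcpos : ∀ i, 0 < c i := order_pos hα ε
  set p := ∑ i, c i with hp
  set q := ∑ i, (α i + 1) with hq
  have hq0 : 0 ≤ q := Finset.sum_nonneg fun i _ => by linarith [hα i]
  have hqp : q ≤ p := Finset.sum_le_sum fun i _ => by
    have : (0 : ℝ) ≤ ((ε i : ℕ) : ℝ) := Nat.cast_nonneg _
    simp only [hc]
    linarith
  have hev : eigenvalue α 0 = 2 * q := by
    rw [eigenvalue, hq, Finset.sum_add_distrib]
    simp
    ring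
  obtain ⟨N, hN⟩ := exists_nat_ge p
  obtain ⟨C, hC0, hC⟩ := exists_pow_mul_exp_le (3 * d + N) hδ
  have hP0 : 0 ≤ ∏ i, A i := Finset.prod_nonneg fun i _ => hA0 i
  refine ⟨(1 + d) * (∏ i, A i) * C, by positivity, fun t x y ht hx hy hxR hyR hd => ?_⟩
  have hs := sinh_two_mul_pos ht
  set v := (Real.sinh (2 * t))⁻¹ with hv
  have hv0 : 0 < v := inv_pos.2 hs
  have hx0 : ∀ i, 0 < x i := fun i => hx i (mem_univ i)
  have hy0 : ∀ i, 0 < y i := fun i => hy i (mem_univ i)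
  set T : Fin d → ℝ := fun i => (1 + v) ^ 3 * v ^ c i * Real.exp (-((x i - y i) ^ 2 / 2) * v)
    with hT
  have hAT0 : ∀ i, 0 ≤ A i * T i := fun i => mul_nonneg (hA0 i) (by positivity)
  have hmain : ∏ i, A i * T i ≤ (∏ i, A i) * C * Real.exp (-t * eigenvalue α 0) := by
    have hprod : ∏ i, T i = (1 + v) ^ (3 * d) * v ^ p *
        Real.exp (-((∑ i, (x i - y i) ^ 2) / 2) * v) := by
      simp only [hT]
      rw [Finset.prod_mul_distrib, Finset.prod_mul_distrib, Finset.prod_const, Finset.card_univ,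
        Fintype.card_fin, ← pow_mul, ← Real.exp_sum, hp, Real.rpow_sum_of_pos hv0,
        ← Finset.sum_mul, Finset.sum_neg_distrib, Finset.sum_div]
    -- `v ≤ (2 + v) e^{-2t}`, because `e^{2t} = cosh 2t + sinh 2t ≤ 1 + 2 sinh 2t`
    have hvexp : v ≤ (2 + v) * Real.exp (-(2 * t)) := by
      have h1 : Real.cosh (2 * t) - Real.sinh (2 * t) ≤ 1 := by
        rw [Real.cosh_sub_sinh, Real.exp_le_one_iff]
        linarith
      have h2 : Real.exp (2 * t) ≤ 1 + 2 * Real.sinh (2 * t) := by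
        rw [← Real.cosh_add_sinh]
        linarith
      rw [Real.exp_neg, ← div_eq_mul_inv, le_div_iff₀ (Real.exp_pos _)]
      calc v * Real.exp (2 * t) ≤ v * (1 + 2 * Real.sinh (2 * t)) := by gcongr
        _ = _ := by rw [hv]; field_simp; ring
    -- as `q = λ_0 / 2`, the power `v ^ q` decays like `e^{-λ_0 t}`
    have hvp : v ^ p ≤ (2 + v) ^ N * Real.exp (-t * eigenvalue α 0) := by
      have h1 : v ^ q ≤ (2 + v) ^ q * Real.exp (-t * eigenvalue α 0) := by
        calc v ^ q ≤ ((2 + v) * Real.exp (-(2 * t))) ^ q :=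
              Real.rpow_le_rpow hv0.le hvexp hq0
          _ = _ := by
              rw [Real.mul_rpow (by positivity) (by positivity), ← Real.exp_mul, hev]
              congr 2
              ring
      have h2 : v ^ (p - q) ≤ (2 + v) ^ (p - q) :=
        Real.rpow_le_rpow hv0.le (by linarith) (by linarith)
      calc v ^ p = v ^ (p - q) * v ^ q := by
            rw [← Real.rpow_add hv0]
            congr 1
            ring
        _ ≤ (2 + v) ^ (p - q) * ((2 + v) ^ q * Real.exp (-t * eigenvalue α 0)) := by gcongr
        _ = (2 + v) ^ p * Real.exp (-t * eigenvalue α 0) := by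
            rw [← mul_assoc, ← Real.rpow_add (by positivity)]
            congr 2
            ring
        _ ≤ _ := by
            rw [← Real.rpow_natCast]
            gcongr
            linarith
    rw [Finset.prod_mul_distrib, hprod, mul_assoc (∏ i, A i)]
    refine mul_le_mul_of_nonneg_left ?_ hP0
    calc _ ≤ (2 + v) ^ (3 * d) * ((2 + v) ^ N * Real.exp (-t * eigenvalue α 0)) *
          Real.exp (-(δ / 2) * v) := by
          gcongr
          norm_num
      _ = (2 + v) ^ (3 * d + N) * Real.exp (-(δ / 2) * v) *
          Real.exp (-t * eigenvalue α 0) := by ring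
      _ ≤ _ := by
          gcongr
          exact hC v hv0.le
  have hE := Real.exp_pos (-t * eigenvalue α 0)
  have hd0 : (0 : ℝ) ≤ d := d.cast_nonneg
  have hPCE : 0 ≤ (∏ i, A i) * C * Real.exp (-t * eigenvalue α 0) := by positivity
  constructor
  · rw [heatKernel_eq_prod α ε ht hx hy, Finset.abs_prod]
    calc _ ≤ ∏ i, A i * T i := Finset.prod_le_prod (fun i _ => abs_nonneg _) fun i _ =>
          (hA i t (x i) (y i) ht (hx0 i) (hy0 i) (hxR i) (hyR i)).1
      _ ≤ _ := hmain
      _ ≤ _ := by nlinarith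
  · rw [heatKernelDeriv]
    calc _ ≤ ∑ i, |(∏ j ∈ Finset.univ.erase i,
          heatKernel₁ (α j + (ε j : ℕ) + 1) (ε j : ℕ) t (x j) (y j)) *
            heatKernelDeriv₁ (α i + (ε i : ℕ) + 1) (ε i : ℕ) t (x i) (y i)| :=
          Finset.abs_sum_le_sum_abs _ _
      _ ≤ ∑ _i : Fin d, ∏ i, A i * T i := by
          refine Finset.sum_le_sum fun i _ => ?_
          rw [abs_mul, Finset.abs_prod, ← Finset.prod_erase_mul _ _ (Finset.mem_univ i)]
          refine mul_le_mul (Finset.prod_le_prod (fun j _ => abs_nonneg _) fun j _ =>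
            (hA j t (x j) (y j) ht (hx0 j) (hy0 j) (hxR j) (hyR j)).1)
            (hA i t (x i) (y i) ht (hx0 i) (hy0 i) (hxR i) (hyR i)).2 (abs_nonneg _)
            (Finset.prod_nonneg fun j _ => hAT0 j)
      _ = d * ∏ i, A i * T i := by simp
      _ ≤ d * ((∏ i, A i) * C * Real.exp (-t * eigenvalue α 0)) := by gcongr
      _ ≤ _ := by nlinarith

lemma continuousOn_heatKernel₁ {c : ℝ} (hc : 0 < c) (e : ℕ) :
    ContinuousOn (fun p : ℝ × ℝ × ℝ => heatKernel₁ c e p.1 p.2.1 p.2.2) {p | 0 < p.1} := by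
  intro p hp
  have hs := (sinh_two_mul_pos hp).ne'
  have hs2 : 2 * Real.sinh (2 * p.1) ≠ 0 := mul_ne_zero two_ne_zero hs
  have hb := continuous_besselSeries hc
  refine ContinuousAt.continuousWithinAt ?_
  have h1 : ContinuousAt (fun p : ℝ × ℝ × ℝ => 2 * Real.sinh (2 * p.1)) p := by fun_prop
  have h2 : ContinuousAt (fun p : ℝ × ℝ × ℝ => (2 * Real.sinh (2 * p.1)) ^ (-c)) p :=
    h1.rpow_const (Or.inl hs2)
  have h3 : ContinuousAt (fun p : ℝ × ℝ × ℝ => besselSeries c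
      ((p.2.1 * p.2.2 / (2 * Real.sinh (2 * p.1))) ^ 2)) p :=
    hb.continuousAt.comp (f := fun p : ℝ × ℝ × ℝ =>
      (p.2.1 * p.2.2 / (2 * Real.sinh (2 * p.1))) ^ 2) (by fun_prop (disch := assumption))
  have h4 : ContinuousAt (fun p : ℝ × ℝ × ℝ => Real.cosh (2 * p.1) / Real.sinh (2 * p.1)) p :=
    ContinuousAt.div (by fun_prop) (by fun_prop) hs
  have h5 : ContinuousAt (fun p : ℝ × ℝ × ℝ => Real.exp (-(1 / 2) *
      (Real.cosh (2 * p.1) / Real.sinh (2 * p.1)) * (p.2.1 ^ 2 + p.2.2 ^ 2))) p := by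
    fun_prop
  have h6 : ContinuousAt (fun p : ℝ × ℝ × ℝ => (p.2.1 * p.2.2) ^ e) p := by fun_prop
  exact ((h6.mul h2).mul h5).mul h3

lemma continuousOn_heatKernelDeriv₁ {c : ℝ} (hc : 0 < c) (e : ℕ) :
    ContinuousOn (fun p : ℝ × ℝ × ℝ => heatKernelDeriv₁ c e p.1 p.2.1 p.2.2)
      {p | 0 < p.1} := by
  intro p hp
  have hs := (sinh_two_mul_pos hp).ne'
  have hs2 : 2 * Real.sinh (2 * p.1) ≠ 0 := mul_ne_zero two_ne_zero hs
  have hs3 : Real.sinh (2 * p.1) ^ 2 ≠ 0 := pow_ne_zero 2 hs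
  refine ContinuousAt.continuousWithinAt ?_
  have h1 : ContinuousAt (fun p : ℝ × ℝ × ℝ => 2 * Real.sinh (2 * p.1)) p := by fun_prop
  have h2 : ContinuousAt (fun p : ℝ × ℝ × ℝ => (2 * Real.sinh (2 * p.1)) ^ (-c)) p :=
    h1.rpow_const (Or.inl hs2)
  have h3 : ∀ b : ℝ, 0 < b → ContinuousAt (fun p : ℝ × ℝ × ℝ => besselSeries b
      ((p.2.1 * p.2.2 / (2 * Real.sinh (2 * p.1))) ^ 2)) p := fun b hb =>
    (continuous_besselSeries hb).continuousAt.comp (f := fun p : ℝ × ℝ × ℝ =>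
      (p.2.1 * p.2.2 / (2 * Real.sinh (2 * p.1))) ^ 2) (by fun_prop (disch := assumption))
  have h4 := h3 c hc
  have h5 := h3 (c + 1) (by linarith)
  have h6 : ContinuousAt (fun p : ℝ × ℝ × ℝ => Real.cosh (2 * p.1) / Real.sinh (2 * p.1)) p :=
    ContinuousAt.div (by fun_prop) (by fun_prop) hs
  have h7 : ContinuousAt (fun p : ℝ × ℝ × ℝ => Real.exp (-(1 / 2) *
      (Real.cosh (2 * p.1) / Real.sinh (2 * p.1)) * (p.2.1 ^ 2 + p.2.2 ^ 2))) p := by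
    fun_prop
  have h8 : ContinuousAt (fun p : ℝ × ℝ × ℝ => (p.2.1 * p.2.2) ^ e) p := by fun_prop
  have h9 : ContinuousAt (fun p : ℝ × ℝ × ℝ =>
      (p.2.1 ^ 2 + p.2.2 ^ 2) / Real.sinh (2 * p.1) ^ 2) p :=
    ContinuousAt.div (by fun_prop) (by fun_prop) hs3
  have h10 : ContinuousAt (fun p : ℝ × ℝ × ℝ => (p.2.1 * p.2.2) ^ 2 *
      (Real.cosh (2 * p.1) / Real.sinh (2 * p.1)) / Real.sinh (2 * p.1) ^ 2) p :=
    ContinuousAt.div (by fun_prop) (by fun_prop) hs3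
  exact ((h8.mul h2).mul h7).mul ((((h6.const_mul _).add h9).mul h4).sub (h10.mul h5))

/-- The set of all `(t, x, y)` with `t > 0` and `x, y ∈ (0,∞)^d`. -/
def heatDomain (d : ℕ) : Set (ℝ × (Fin d → ℝ) × (Fin d → ℝ)) :=
  Ioi 0 ×ˢ ((orthant d : Set (Fin d → ℝ)) ×ˢ (orthant d : Set (Fin d → ℝ)))

lemma continuousOn_heatKernel₁_coord {d : ℕ} {f : ℝ → ℝ → ℝ → ℝ}
    (hf : ContinuousOn (fun p : ℝ × ℝ × ℝ => f p.1 p.2.1 p.2.2) {p | 0 < p.1}) (i : Fin d) :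
    ContinuousOn (fun p : ℝ × (Fin d → ℝ) × (Fin d → ℝ) => f p.1 (p.2.1 i) (p.2.2 i))
      (heatDomain d) :=
  hf.comp (f := fun p : ℝ × (Fin d → ℝ) × (Fin d → ℝ) => (p.1, p.2.1 i, p.2.2 i))
    (by fun_prop) fun _ hp => hp.1

lemma continuousOn_heatKernel {d : ℕ} {α : Fin d → ℝ} (hα : ∀ i, -1 / 2 ≤ α i)
    (ε : Fin d → Fin 2) :
    ContinuousOn (fun p : ℝ × (Fin d → ℝ) × (Fin d → ℝ) => heatKernel α ε p.1 p.2.1 p.2.2)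
      (heatDomain d) := by
  have h : ContinuousOn (fun p : ℝ × (Fin d → ℝ) × (Fin d → ℝ) =>
      ∏ i, heatKernel₁ (α i + (ε i : ℕ) + 1) (ε i : ℕ) p.1 (p.2.1 i) (p.2.2 i))
      (heatDomain d) :=
    continuousOn_finsetProd _ fun i _ =>
      continuousOn_heatKernel₁_coord (continuousOn_heatKernel₁ (order_pos hα ε i) _) i
  exact h.congr fun p hp => heatKernel_eq_prod α ε hp.1 hp.2.1 hp.2.2

lemma continuousOn_heatKernelDeriv {d : ℕ} {α : Fin d → ℝ} (hα : ∀ i, -1 / 2 ≤ α i)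
    (ε : Fin d → Fin 2) :
    ContinuousOn (fun p : ℝ × (Fin d → ℝ) × (Fin d → ℝ) =>
      heatKernelDeriv α ε p.1 p.2.1 p.2.2) (heatDomain d) :=
  continuousOn_finsetSum _ fun i _ => (continuousOn_finsetProd _ fun j _ =>
    continuousOn_heatKernel₁_coord (continuousOn_heatKernel₁ (order_pos hα ε j) _) j).mul
      (continuousOn_heatKernel₁_coord (continuousOn_heatKernelDeriv₁ (order_pos hα ε i) _) i)

/-! ### Pairings with test functions -/

lemma isLocallyFiniteMeasure_wPlus {d : ℕ} {α : Fin d → ℝ} (hα : ∀ i, -1 / 2 ≤ α i) :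
    IsLocallyFiniteMeasure (wPlus α) := by
  have hw : Continuous fun x : Fin d → ℝ => ∏ i, |x i| ^ (2 * α i + 1) := by
    refine continuous_finsetProd _ fun i _ => ?_
    refine Continuous.rpow_const (by fun_prop) fun x => Or.inr ?_
    linarith [hα i]
  exact IsLocallyFiniteMeasure.withDensity_ofReal hw

lemma ae_mem_orthant {d : ℕ} (α : Fin d → ℝ) : ∀ᵐ x ∂(wPlus α), x ∈ orthant d :=
  (withDensity_absolutelyContinuous _ _).ae_le
    (ae_restrict_mem (orthant d).isOpen.measurableSet)

lemma integrable_testFunction {d : ℕ} {α : Fin d → ℝ} (hα : ∀ i, -1 / 2 ≤ α i)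
    (f : TestFunction (orthant d) ℂ ⊤) : Integrable f (wPlus α) := by
  have := isLocallyFiniteMeasure_wPlus hα
  exact f.continuous.integrable_of_hasCompactSupport f.hasCompactSupport

lemma inner_hermiteL2_testFunction {d : ℕ} {α : Fin d → ℝ} (hα : ∀ i, -1 / 2 ≤ α i)
    (k : Fin d → ℕ) (f : TestFunction (orthant d) ℂ ⊤) :
    inner ℂ (hermiteL2 α hα k) (memLp_testFunction α hα f).toLp =
      ∫ y, (hermite α k y : ℂ) * f y ∂(wPlus α) := by
  rw [L2.inner_def]
  refine integral_congr_ae ?_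
  filter_upwards [(memLp_hermite α hα k).coeFn_toLp, (memLp_testFunction α hα f).coeFn_toLp]
    with x hk hf
  rw [hermiteL2, hk, hf]
  simp [mul_comm]

lemma inner_testFunction_hermiteL2 {d : ℕ} {α : Fin d → ℝ} (hα : ∀ i, -1 / 2 ≤ α i)
    (k : Fin d → ℕ) (g : TestFunction (orthant d) ℂ ⊤) :
    inner ℂ (memLp_testFunction α hα g).toLp (hermiteL2 α hα k) =
      ∫ x, (hermite α k x : ℂ) * (starRingEnd ℂ) (g x) ∂(wPlus α) := by
  rw [L2.inner_def]
  refine integral_congr_ae ?_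
  filter_upwards [(memLp_hermite α hα k).coeFn_toLp, (memLp_testFunction α hα g).coeFn_toLp]
    with x hk hf
  rw [hermiteL2, hk, hf]
  simp

lemma inner_testFunction_L2 {d : ℕ} {α : Fin d → ℝ} (hα : ∀ i, -1 / 2 ≤ α i)
    (g : TestFunction (orthant d) ℂ ⊤) (u : L2Plus α) :
    inner ℂ (memLp_testFunction α hα g).toLp u =
      ∫ x, (u : (Fin d → ℝ) → ℂ) x * (starRingEnd ℂ) (g x) ∂(wPlus α) := by
  rw [L2.inner_def]
  refine integral_congr_ae ?_
  filter_upwards [(memLp_testFunction α hα g).coeFn_toLp] with x hf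
  rw [hf]
  simp

lemma integrable_hermite_mul {d : ℕ} {α : Fin d → ℝ} (hα : ∀ i, -1 / 2 ≤ α i)
    (k : Fin d → ℕ) {f : (Fin d → ℝ) → ℂ} (hf : MemLp f 2 (wPlus α)) :
    Integrable (fun y => (hermite α k y : ℂ) * f y) (wPlus α) :=
  (memLp_hermite α hα k).integrable_mul hf

/-- By the normalization of `h_k^α`, this bound does not depend on `k`. -/
lemma integral_norm_hermite_mul_le {d : ℕ} {α : Fin d → ℝ} (hα : ∀ i, -1 / 2 ≤ α i)
    (k : Fin d → ℕ) {f : (Fin d → ℝ) → ℂ} (hf : MemLp f 2 (wPlus α)) :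
    ∫ y, ‖(hermite α k y : ℂ) * f y‖ ∂(wPlus α) ≤ (1 / 2) ^ d + ∫ y, ‖f y‖ ^ 2 ∂(wPlus α) := by
  have h1 := (memLp_two_iff_integrable_sq_norm (memLp_hermite α hα k).1).1 (memLp_hermite α hα k)
  have h2 := (memLp_two_iff_integrable_sq_norm hf.1).1 hf
  have e : ∫ y, ‖(hermite α k y : ℂ)‖ ^ 2 ∂(wPlus α) = (1 / 2) ^ d := by
    have := integral_hermite_mul hα (k := k) (l := k) fun _ => rfl
    rw [if_pos rfl] at this
    rw [← this]
    refine integral_congr_ae (.of_forall fun y => ?_)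
    simp only [Complex.norm_real, Real.norm_eq_abs, sq_abs]
    ring
  rw [← e, ← integral_add h1 h2]
  refine integral_mono (integrable_hermite_mul hα k hf).norm (h1.add h2) fun y => ?_
  simp only [norm_mul]
  nlinarith [sq_nonneg (‖(hermite α k y : ℂ)‖ - ‖f y‖), sq_nonneg ‖(hermite α k y : ℂ)‖,
    sq_nonneg ‖f y‖]

lemma memLp_conj_testFunction {d : ℕ} {α : Fin d → ℝ} (hα : ∀ i, -1 / 2 ≤ α i)
    (g : TestFunction (orthant d) ℂ ⊤) :
    MemLp (fun x => (starRingEnd ℂ) (g x)) 2 (wPlus α) :=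
  (memLp_testFunction α hα g).star

lemma eigenvalue_zero_le {d : ℕ} (α : Fin d → ℝ) (n : ℕ) : eigenvalue α 0 ≤ eigenvalue α n := by
  unfold eigenvalue
  have : (0 : ℝ) ≤ n := n.cast_nonneg
  push_cast
  linarith

lemma le_eigenvalue_zero {d : ℕ} {α : Fin d → ℝ} (hα : ∀ i, -1 / 2 ≤ α i) :
    (d : ℝ) ≤ eigenvalue α 0 := by
  have h : ∑ _i : Fin d, (-1 / 2 : ℝ) ≤ ∑ i, α i := Finset.sum_le_sum fun i _ => hα i
  simp only [Finset.sum_const, Finset.card_univ, Fintype.card_fin, nsmul_eq_mul] at h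
  unfold eigenvalue
  push_cast
  linarith

lemma eigenvalue_nonneg {d : ℕ} {α : Fin d → ℝ} (hα : ∀ i, -1 / 2 ≤ α i) (n : ℕ) :
    0 ≤ eigenvalue α n :=
  d.cast_nonneg.trans ((le_eigenvalue_zero hα).trans (eigenvalue_zero_le α n))

lemma summable_exp_eigenvalue {d : ℕ} (α : Fin d → ℝ) (ε : Fin d → Fin 2) {t : ℝ} (ht : 0 < t) :
    Summable fun k : ParityIndex ε => Real.exp (-t * eigenvalue α (∑ i, k.1 i)) := by
  have h1 : ∀ i, Summable fun n : ℕ => Real.exp (-t * (2 * n + 2 * α i + 2)) := by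
    intro i
    have h := (summable_geometric_of_lt_one (Real.exp_pos (-t * 2)).le
      (by rw [Real.exp_lt_one_iff]; linarith)).mul_left (Real.exp (-t * (2 * α i + 2)))
    refine h.congr fun n => ?_
    rw [← Real.exp_nat_mul, ← Real.exp_add]
    congr 1
    ring
  have h := (hasSum_fin_prod fun i => (h1 i).hasSum).summable.comp_injective
    (Subtype.val_injective (p := fun k : Fin d → ℕ => ∀ i, k i % 2 = (ε i : ℕ)))
  refine h.congr fun k => ?_
  rw [Function.comp_apply, ← Real.exp_sum, ← Finset.mul_sum, ← eigenvalue_sum]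

/-- The coefficient `⟨f, h_k⟩ ⟨h_k, g⟩` in the expansion of `⟨m(𝓛_α) f, g⟩`. -/
noncomputable def pairCoeff {d : ℕ} {α : Fin d → ℝ} (hα : ∀ i, -1 / 2 ≤ α i)
    (f g : TestFunction (orthant d) ℂ ⊤) (k : Fin d → ℕ) : ℂ :=
  inner ℂ (hermiteL2 α hα k) (memLp_testFunction α hα f).toLp *
    inner ℂ (memLp_testFunction α hα g).toLp (hermiteL2 α hα k)

lemma summable_norm_pairCoeff {d : ℕ} {α : Fin d → ℝ} (hα : ∀ i, -1 / 2 ≤ α i)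
    (ε : Fin d → Fin 2) (f g : TestFunction (orthant d) ℂ ⊤) :
    Summable fun k : ParityIndex ε => ‖pairCoeff hα f g k.1‖ :=
  summable_inner_mul_inner hα ε _ _

/-- The heat semigroup is given by the heat kernel, in weak form. -/
lemma hasSum_heatKernel_pairing {d : ℕ} {α : Fin d → ℝ} (hα : ∀ i, -1 / 2 ≤ α i)
    (ε : Fin d → Fin 2) {t : ℝ} (ht : 0 < t) (f g : TestFunction (orthant d) ℂ ⊤) :
    HasSum (fun k : ParityIndex ε =>
        (Real.exp (-t * eigenvalue α (∑ i, k.1 i)) : ℂ) * pairCoeff hα f g k.1)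
      (∫ p, (heatKernel α ε t p.1 p.2 : ℂ) * f p.2 * (starRingEnd ℂ) (g p.1)
        ∂((wPlus α).prod (wPlus α))) := by
  have := isLocallyFiniteMeasure_wPlus hα
  have hf := memLp_testFunction α hα f
  have hg := memLp_conj_testFunction hα g
  let F : ParityIndex ε → (Fin d → ℝ) × (Fin d → ℝ) → ℂ := fun k p =>
    (Real.exp (-t * eigenvalue α (∑ i, k.1 i)) : ℂ) *
      (((hermite α k.1 p.1 : ℂ) * (starRingEnd ℂ) (g p.1)) * ((hermite α k.1 p.2 : ℂ) * f p.2))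
  have hFi : ∀ k, Integrable (F k) ((wPlus α).prod (wPlus α)) := fun k =>
    ((integrable_hermite_mul hα k.1 hg).mul_prod (integrable_hermite_mul hα k.1 hf)).const_mul _
  have hFs : Summable fun k => ∫ p, ‖F k p‖ ∂((wPlus α).prod (wPlus α)) := by
    refine .of_nonneg_of_le (fun k => integral_nonneg fun _ => norm_nonneg _) (fun k => ?_)
      ((summable_exp_eigenvalue α ε ht).mul_right
        (((1 / 2) ^ d + ∫ x, ‖(starRingEnd ℂ) (g x)‖ ^ 2 ∂(wPlus α)) *
        ((1 / 2) ^ d + ∫ y, ‖f y‖ ^ 2 ∂(wPlus α))))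
    have e : ∀ p, ‖F k p‖ = Real.exp (-t * eigenvalue α (∑ i, k.1 i)) *
        (‖(hermite α k.1 p.1 : ℂ) * (starRingEnd ℂ) (g p.1)‖ *
          ‖(hermite α k.1 p.2 : ℂ) * f p.2‖) := by
      intro p
      rw [norm_mul, norm_mul (_ * _) (_ * _), Complex.norm_real,
        Real.norm_of_nonneg (Real.exp_pos _).le]
    simp only [e]
    rw [integral_const_mul, integral_prod_mul
      (fun x => ‖(hermite α k.1 x : ℂ) * (starRingEnd ℂ) (g x)‖)
      (fun y => ‖(hermite α k.1 y : ℂ) * f y‖)]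
    refine mul_le_mul_of_nonneg_left ?_ (Real.exp_pos _).le
    refine mul_le_mul (integral_norm_hermite_mul_le hα k.1 hg)
      (integral_norm_hermite_mul_le hα k.1 hf) (integral_nonneg fun _ => norm_nonneg _) ?_
    exact (integral_nonneg fun _ => norm_nonneg _).trans
      (integral_norm_hermite_mul_le hα k.1 hg)
  refine hasSum_of_eq (hasSum_integral_of_summable_integral_norm hFi hFs) (fun k => ?_) ?_
  · simp only [F]
    rw [integral_const_mul, integral_prod_mul
      (fun x => (hermite α k.1 x : ℂ) * (starRingEnd ℂ) (g x))
      (fun y => (hermite α k.1 y : ℂ) * f y), pairCoeff, inner_hermiteL2_testFunction,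
      inner_testFunction_hermiteL2]
    ring
  · refine integral_congr_ae ?_
    filter_upwards [Measure.quasiMeasurePreserving_fst.ae (ae_mem_orthant α),
      Measure.quasiMeasurePreserving_snd.ae (ae_mem_orthant α)] with p h1 h2
    have h := (hasSum_parityIndex.2 (hasSum_heatKernel hα ε ht h1 h2)).mapL Complex.ofRealCLM
    have h' := (h.mul_right (f p.2)).mul_right ((starRingEnd ℂ) (g p.1))
    rw [← Complex.ofRealCLM_apply, ← h'.tsum_eq]
    refine tsum_congr fun k => ?_
    simp only [F, Complex.ofRealCLM_apply]
    push_cast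
    ring

/-- Off-diagonal bounds on the supports of two test functions with disjoint supports. -/
lemma heatKernel_bounds_tsupport {d : ℕ} {α : Fin d → ℝ} (hα : ∀ i, -1 / 2 ≤ α i)
    (ε : Fin d → Fin 2) {f g : TestFunction (orthant d) ℂ ⊤}
    (hfg : Disjoint (tsupport f) (tsupport g)) :
    ∃ C : ℝ, 0 ≤ C ∧ ∀ (t : ℝ), 0 < t → ∀ x ∈ tsupport g, ∀ y ∈ tsupport f,
      |heatKernel α ε t x y| ≤ C * Real.exp (-t * eigenvalue α 0) ∧
      |heatKernelDeriv α ε t x y| ≤ C * Real.exp (-t * eigenvalue α 0) := by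
  have hcf : IsCompact (tsupport f) := f.hasCompactSupport
  have hcg : IsCompact (tsupport g) := g.hasCompactSupport
  obtain ⟨R, hR0, hR⟩ : ∃ R : ℝ, 0 ≤ R ∧ ∀ x ∈ tsupport f ∪ tsupport g, ‖x‖ ≤ R := by
    obtain ⟨R, hR⟩ := (hcf.union hcg).isBounded.exists_norm_le
    exact ⟨max R 0, le_max_right _ _, fun x hx => (hR x hx).trans (le_max_left _ _)⟩
  obtain ⟨δ, hδ0, hδ⟩ : ∃ δ : ℝ, 0 < δ ∧ ∀ x ∈ tsupport g, ∀ y ∈ tsupport f,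
      δ ≤ ∑ i, (x i - y i) ^ 2 := by
    rcases (tsupport g ×ˢ tsupport f).eq_empty_or_nonempty with he | hne
    · refine ⟨1, one_pos, fun x hx y hy => ?_⟩
      have : (x, y) ∈ tsupport g ×ˢ tsupport f := ⟨hx, hy⟩
      rw [he] at this
      exact this.elim
    · obtain ⟨p, hp, hmin⟩ := (hcg.prod hcf).exists_isMinOn hne
        (f := fun p : (Fin d → ℝ) × (Fin d → ℝ) => ∑ i, (p.1 i - p.2 i) ^ 2)
        (Continuous.continuousOn (by fun_prop))
      refine ⟨∑ i, (p.1 i - p.2 i) ^ 2, ?_, fun x hx y hy =>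
        isMinOn_iff.1 hmin (x, y) ⟨hx, hy⟩⟩
      have hne : p.1 ≠ p.2 := fun h => hfg.ne_of_mem hp.2 hp.1 h.symm
      obtain ⟨i, hi⟩ := Function.ne_iff.1 hne
      exact Finset.sum_pos' (fun j _ => sq_nonneg _)
        ⟨i, Finset.mem_univ i, by have := sub_ne_zero.2 hi; positivity⟩
  obtain ⟨C, hC0, hC⟩ := heatKernel_bounds hα ε hR0 hδ0
  refine ⟨C, hC0, fun t ht x hx y hy => hC t x y ht (g.tsupport_subset hx) (f.tsupport_subset hy)
    (fun i => ?_) (fun i => ?_) (hδ x hx y hy)⟩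
  · exact (Real.le_norm_self _).trans ((norm_le_pi_norm x i).trans (hR x (Or.inr hx)))
  · exact (Real.le_norm_self _).trans ((norm_le_pi_norm y i).trans (hR y (Or.inl hy)))

lemma aestronglyMeasurable_of_continuousOn_heatDomain {d : ℕ} {α : Fin d → ℝ}
    (hα : ∀ i, -1 / 2 ≤ α i) {ν : Measure ℝ} [SFinite ν] (hν : ∀ᵐ t ∂ν, 0 < t)
    {H : ℝ × (Fin d → ℝ) × (Fin d → ℝ) → ℝ} (hH : ContinuousOn H (heatDomain d)) :
    AEStronglyMeasurable H (ν.prod ((wPlus α).prod (wPlus α))) := by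
  have := isLocallyFiniteMeasure_wPlus hα
  have hm : MeasurableSet (heatDomain d) :=
    measurableSet_Ioi.prod ((orthant d).isOpen.measurableSet.prod (orthant d).isOpen.measurableSet)
  have hae : ∀ᵐ p ∂(ν.prod ((wPlus α).prod (wPlus α))), p ∈ heatDomain d := by
    filter_upwards [Measure.quasiMeasurePreserving_fst.ae hν,
      Measure.quasiMeasurePreserving_snd.ae
        (Measure.quasiMeasurePreserving_fst.ae (ae_mem_orthant α)),
      Measure.quasiMeasurePreserving_snd.ae
        (Measure.quasiMeasurePreserving_snd.ae (ae_mem_orthant α))] with p h1 h2 h3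
    exact ⟨h1, h2, h3⟩
  rw [← Measure.restrict_eq_self_of_ae_mem hae]
  exact hH.aestronglyMeasurable hm

/-! ### Multipliers given by integrals over the time variable -/

/-- Let `m(λ) = ∫ a(λ,t) φ(t) dν(t)`, and suppose that for each `t > 0` the multiplier `a(·,t)` has
the kernel `H_t` in the weak sense. If `H_t` is dominated on the supports of the test functions by
an integrable function of `t`, then integration over `t` shows that `m` has the kernel
`∫ H_t φ(t) dν(t)`. -/
lemma isAssociatedWith_of_integral {d : ℕ} {α : Fin d → ℝ} (hα : ∀ i, -1 / 2 ≤ α i)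
    (ε : Fin d → Fin 2) {ν : Measure ℝ} [SFinite ν] (hν : ∀ᵐ t ∂ν, 0 < t)
    {φ : ℝ → ℂ} (hφ : AEStronglyMeasurable φ ν)
    {H : ℝ → (Fin d → ℝ) → (Fin d → ℝ) → ℝ}
    (hH : ContinuousOn (fun p : ℝ × (Fin d → ℝ) × (Fin d → ℝ) => H p.1 p.2.1 p.2.2)
      (heatDomain d))
    {B : ℝ → ℝ} (hB : Integrable (fun t => B t * ‖φ t‖) ν)
    (hHB : ∀ f g : TestFunction (orthant d) ℂ ⊤, Disjoint (tsupport f) (tsupport g) →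
      ∃ C : ℝ, ∀ t, 0 < t → ∀ x ∈ tsupport g, ∀ y ∈ tsupport f, |H t x y| ≤ C * B t)
    {a : ℝ → ℝ → ℝ}
    (hHa : ∀ f g : TestFunction (orthant d) ℂ ⊤, Disjoint (tsupport f) (tsupport g) →
      ∀ t, 0 < t → HasSum (fun k : ParityIndex ε =>
        (a (eigenvalue α (∑ i, k.1 i)) t : ℂ) * pairCoeff hα f g k.1)
        (∫ p, (H t p.1 p.2 : ℂ) * f p.2 * (starRingEnd ℂ) (g p.1)
          ∂((wPlus α).prod (wPlus α))))
    {m : ℝ → ℂ} (hm : ∀ n, m (eigenvalue α n) = ∫ t, (a (eigenvalue α n) t : ℂ) * φ t ∂ν)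
    (ham : ∀ n, Integrable (fun t => (a (eigenvalue α n) t : ℂ) * φ t) ν)
    {M : ℝ} (hM : ∀ n, ∫ t, ‖(a (eigenvalue α n) t : ℂ) * φ t‖ ∂ν ≤ M)
    {K : (Fin d → ℝ) → (Fin d → ℝ) → ℂ}
    (hK : ∀ x ∈ orthant d, ∀ y ∈ orthant d, K x y = ∫ t, (H t x y : ℂ) * φ t ∂ν) :
    IsAssociatedWith α hα (multiplierOp α hα ε m) K := by
  have := isLocallyFiniteMeasure_wPlus hα
  intro f g hfg
  have hmM : ∀ n, ‖m (eigenvalue α n)‖ ≤ M := fun n => by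
    rw [hm]
    exact (norm_integral_le_integral_norm _).trans (hM n)
  have hfi := integrable_testFunction hα f
  have hgi : Integrable (fun x => (starRingEnd ℂ) (g x)) (wPlus α) :=
    Complex.conjCLE.toContinuousLinearMap.integrable_comp (integrable_testFunction hα g)
  obtain ⟨C, hC⟩ := hHB f g hfg
  let Φ : ℝ × (Fin d → ℝ) × (Fin d → ℝ) → ℂ := fun p =>
    (H p.1 p.2.1 p.2.2 : ℂ) * φ p.1 * (f p.2.2 * (starRingEnd ℂ) (g p.2.1))
  have hΦ : Integrable Φ (ν.prod ((wPlus α).prod (wPlus α))) := by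
    have hbound : Integrable (fun p : ℝ × (Fin d → ℝ) × (Fin d → ℝ) =>
        (C * (B p.1 * ‖φ p.1‖)) * (‖(starRingEnd ℂ) (g p.2.1)‖ * ‖f p.2.2‖))
        (ν.prod ((wPlus α).prod (wPlus α))) :=
      (hB.const_mul C).mul_prod (hgi.norm.mul_prod hfi.norm)
    refine hbound.mono' ?_ ?_
    · have h1 := Complex.continuous_ofReal.comp_aestronglyMeasurable
        (aestronglyMeasurable_of_continuousOn_heatDomain hα hν hH)
      have h2 : AEStronglyMeasurable (fun p : ℝ × (Fin d → ℝ) × (Fin d → ℝ) => φ p.1)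
          (ν.prod ((wPlus α).prod (wPlus α))) := hφ.comp_fst
      have h3 : Continuous fun p : ℝ × (Fin d → ℝ) × (Fin d → ℝ) =>
          f p.2.2 * (starRingEnd ℂ) (g p.2.1) := by
        have := f.continuous
        have := g.continuous
        have := Complex.continuous_conj
        fun_prop
      exact (h1.mul h2).mul h3.aestronglyMeasurable
    · filter_upwards [Measure.quasiMeasurePreserving_fst.ae hν] with p hp
      simp only [Φ, norm_mul, Complex.norm_real, RCLike.norm_conj, Real.norm_eq_abs]
      by_cases hf : p.2.2 ∈ tsupport f
      · by_cases hg : p.2.1 ∈ tsupport g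
        · have := hC p.1 hp p.2.1 hg p.2.2 hf
          calc _ ≤ (C * B p.1) * ‖φ p.1‖ * (‖f p.2.2‖ * ‖g p.2.1‖) := by gcongr
            _ = _ := by ring
        · simp [image_eq_zero_of_notMem_tsupport hg]
      · simp [image_eq_zero_of_notMem_tsupport hf]
  have hKΦ : ∀ p : (Fin d → ℝ) × (Fin d → ℝ),
      ∫ t, Φ (t, p) ∂ν = K p.1 p.2 * f p.2 * (starRingEnd ℂ) (g p.1) := by
    intro p
    simp only [Φ]
    rw [integral_mul_const]
    by_cases hf : p.2 ∈ tsupport f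
    · by_cases hg : p.1 ∈ tsupport g
      · rw [hK _ (g.tsupport_subset hg) _ (f.tsupport_subset hf), mul_assoc]
      · simp [image_eq_zero_of_notMem_tsupport hg]
    · simp [image_eq_zero_of_notMem_tsupport hf]
  have hKi : Integrable (fun p : (Fin d → ℝ) × (Fin d → ℝ) =>
      K p.1 p.2 * f p.2 * (starRingEnd ℂ) (g p.1)) ((wPlus α).prod (wPlus α)) :=
    hΦ.integral_prod_right.congr (.of_forall hKΦ)
  refine ⟨hKi, ?_⟩
  have hsum : Summable fun k : ParityIndex ε => ∫ t, ‖((a (eigenvalue α (∑ i, k.1 i)) t : ℂ) *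
      φ t) * pairCoeff hα f g k.1‖ ∂ν := by
    refine .of_nonneg_of_le (fun k => integral_nonneg fun _ => norm_nonneg _) (fun k => ?_)
      ((summable_norm_pairCoeff hα ε f g).mul_left M)
    simp only [norm_mul _ (pairCoeff hα f g k.1)]
    rw [integral_mul_const]
    gcongr
    exact hM _
  have hswap := hasSum_integral_of_summable_integral_norm
    (fun k : ParityIndex ε => (ham (∑ i, k.1 i)).mul_const (pairCoeff hα f g k.1)) hsum
  simp only [integral_mul_const, ← hm] at hswap
  rw [← inner_testFunction_L2 hα, (hasSum_inner_multiplierOp hα ε hmM _ _).unique hswap]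
  calc _ = ∫ t, ∫ p, Φ (t, p) ∂((wPlus α).prod (wPlus α)) ∂ν := by
        refine integral_congr_ae ?_
        filter_upwards [hν] with t ht
        have h := (hHa f g hfg t ht).mul_right (φ t)
        rw [← integral_mul_const] at h
        simp only [mul_right_comm _ (pairCoeff hα f g _) (φ t)] at h
        rw [h.tsum_eq]
        refine integral_congr_ae (.of_forall fun p => ?_)
        simp only [Φ]
        ring
    _ = ∫ p, ∫ t, Φ (t, p) ∂ν ∂((wPlus α).prod (wPlus α)) :=
        integral_integral_swap (f := fun t p => Φ (t, p)) hΦ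
    _ = ∫ p, K p.1 p.2 * f p.2 * (starRingEnd ℂ) (g p.1) ∂((wPlus α).prod (wPlus α)) := by
        simp only [hKΦ]
    _ = _ := by
        rw [integral_prod _ hKi]
        simp only [integral_mul_const]

/-! ### The time derivative of the heat semigroup -/

/-- The weak form of `-∂_t e^{-t𝓛_α} = 𝓛_α e^{-t𝓛_α}`, for test functions with disjoint supports. -/
lemma hasSum_heatKernelDeriv_pairing {d : ℕ} {α : Fin d → ℝ} (hα : ∀ i, -1 / 2 ≤ α i)
    (ε : Fin d → Fin 2) {f g : TestFunction (orthant d) ℂ ⊤}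
    (hfg : Disjoint (tsupport f) (tsupport g)) {t : ℝ} (ht : 0 < t) :
    HasSum (fun k : ParityIndex ε =>
        ((eigenvalue α (∑ i, k.1 i) * Real.exp (-t * eigenvalue α (∑ i, k.1 i)) : ℝ) : ℂ) *
          pairCoeff hα f g k.1)
      (∫ p, ((-heatKernelDeriv α ε t p.1 p.2 : ℝ) : ℂ) * f p.2 * (starRingEnd ℂ) (g p.1)
        ∂((wPlus α).prod (wPlus α))) := by
  have := isLocallyFiniteMeasure_wPlus hα
  set Λ : ParityIndex ε → ℝ := fun k => eigenvalue α (∑ i, k.1 i) with hΛ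
  set P : ParityIndex ε → ℂ := fun k => pairCoeff hα f g k.1 with hP
  have hPs : Summable fun k => ‖P k‖ := summable_norm_pairCoeff hα ε f g
  have hΛ0 : ∀ k, 0 ≤ Λ k := fun k => eigenvalue_nonneg hα _
  -- termwise differentiation of the series on `(t/2, ∞)`
  have hbd : ∀ (k : ParityIndex ε) (s : ℝ), s ∈ Ioi (t / 2) →
      ‖((-(Λ k * Real.exp (-s * Λ k)) : ℝ) : ℂ) * P k‖ ≤ 2 / t * ‖P k‖ := by
    intro k s hs
    have hs : t / 2 < s := hs
    rw [norm_mul, Complex.norm_real, norm_neg,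
      Real.norm_of_nonneg (mul_nonneg (hΛ0 k) (Real.exp_pos _).le)]
    gcongr
    have h1 : t / 2 * Λ k ≤ Real.exp (s * Λ k) :=
      (mul_le_mul_of_nonneg_right hs.le (hΛ0 k)).trans
        ((lt_add_one _).le.trans (Real.add_one_le_exp _))
    rw [neg_mul, Real.exp_neg, ← div_eq_mul_inv, div_le_div_iff₀ (Real.exp_pos _) ht]
    linarith
  have hts : t ∈ Ioi (t / 2) := by
    rw [mem_Ioi]
    linarith
  have hder1 := hasDerivAt_tsum_of_isPreconnected (hPs.mul_left (2 / t)) isOpen_Ioi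
    (convex_Ioi (t / 2)).isPreconnected
    (g := fun k s => (Real.exp (-s * Λ k) : ℂ) * P k)
    (g' := fun k s => ((-(Λ k * Real.exp (-s * Λ k)) : ℝ) : ℂ) * P k)
    (fun k s _ => by
      have h : HasDerivAt (fun s : ℝ => Real.exp (-s * Λ k)) (-(Λ k * Real.exp (-s * Λ k))) s := by
        refine ((hasDerivAt_neg s).mul_const (Λ k)).exp.congr_deriv ?_
        ring
      exact h.ofReal_comp.mul_const (P k))
    hbd hts (hasSum_heatKernel_pairing hα ε ht f g).summable hts
  -- differentiation under the integral sign
  obtain ⟨C, hC0, hC⟩ := heatKernel_bounds_tsupport hα ε hfg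
  have hfi := integrable_testFunction hα f
  have hgi : Integrable (fun x => (starRingEnd ℂ) (g x)) (wPlus α) :=
    Complex.conjCLE.toContinuousLinearMap.integrable_comp (integrable_testFunction hα g)
  have hfgc : Continuous fun p : (Fin d → ℝ) × (Fin d → ℝ) =>
      f p.2 * (starRingEnd ℂ) (g p.1) := by
    have := f.continuous
    have := g.continuous
    have := Complex.continuous_conj
    fun_prop
  have hmeas : ∀ {H : ℝ × (Fin d → ℝ) × (Fin d → ℝ) → ℝ}, ContinuousOn H (heatDomain d) →
      ∀ s, 0 < s → AEStronglyMeasurable (fun p : (Fin d → ℝ) × (Fin d → ℝ) =>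
        (H (s, p) : ℂ) * f p.2 * (starRingEnd ℂ) (g p.1)) ((wPlus α).prod (wPlus α)) := by
    intro H hH s hs
    have hm : MeasurableSet ((orthant d : Set (Fin d → ℝ)) ×ˢ (orthant d : Set (Fin d → ℝ))) :=
      (orthant d).isOpen.measurableSet.prod (orthant d).isOpen.measurableSet
    have hae : ∀ᵐ p ∂((wPlus α).prod (wPlus α)),
        p ∈ (orthant d : Set (Fin d → ℝ)) ×ˢ (orthant d : Set (Fin d → ℝ)) := by
      filter_upwards [Measure.quasiMeasurePreserving_fst.ae (ae_mem_orthant α),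
        Measure.quasiMeasurePreserving_snd.ae (ae_mem_orthant α)] with p h1 h2
      exact ⟨h1, h2⟩
    rw [← Measure.restrict_eq_self_of_ae_mem hae]
    have h1 : ContinuousOn (fun p => H (s, p))
        ((orthant d : Set (Fin d → ℝ)) ×ˢ (orthant d : Set (Fin d → ℝ))) :=
      hH.comp (by fun_prop) fun p hp => ⟨hs, hp⟩
    have h2 := (Complex.continuous_ofReal.comp_continuousOn h1).mul hfgc.continuousOn
    refine (h2.aestronglyMeasurable hm).congr (.of_forall fun p => ?_)
    simp only [Pi.mul_apply, Function.comp_apply]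
    ring
  have hdom : ∀ s : ℝ, 0 < s → ∀ (h : ℝ) (p : (Fin d → ℝ) × (Fin d → ℝ)),
      (p.1 ∈ tsupport g → p.2 ∈ tsupport f → |h| ≤ C * Real.exp (-s * eigenvalue α 0)) →
      ‖(h : ℂ) * f p.2 * (starRingEnd ℂ) (g p.1)‖ ≤
        C * (‖(starRingEnd ℂ) (g p.1)‖ * ‖f p.2‖) := by
    intro s hs h p hp
    simp only [norm_mul, Complex.norm_real, RCLike.norm_conj, Real.norm_eq_abs]
    by_cases hf : p.2 ∈ tsupport f
    · by_cases hg : p.1 ∈ tsupport g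
      · have h1 : |h| ≤ C := by
          refine (hp hg hf).trans (mul_le_of_le_one_right hC0 ?_)
          rw [Real.exp_le_one_iff]
          nlinarith [mul_nonneg hs.le (eigenvalue_nonneg hα 0)]
        calc _ ≤ C * ‖f p.2‖ * ‖g p.1‖ := by gcongr
          _ = _ := by ring
      · simp [image_eq_zero_of_notMem_tsupport hg]
    · simp [image_eq_zero_of_notMem_tsupport hf]
  have hbi : Integrable (fun p : (Fin d → ℝ) × (Fin d → ℝ) =>
      C * (‖(starRingEnd ℂ) (g p.1)‖ * ‖f p.2‖)) ((wPlus α).prod (wPlus α)) :=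
    (hgi.norm.mul_prod hfi.norm).const_mul C
  have hder2 := (hasDerivAt_integral_of_dominated_loc_of_deriv_le
    (μ := (wPlus α).prod (wPlus α)) (x₀ := t) (s := Ioi 0)
    (F := fun s p => (heatKernel α ε s p.1 p.2 : ℂ) * f p.2 * (starRingEnd ℂ) (g p.1))
    (F' := fun s p => (heatKernelDeriv α ε s p.1 p.2 : ℂ) * f p.2 * (starRingEnd ℂ) (g p.1))
    (Ioi_mem_nhds ht)
    (by filter_upwards [lt_mem_nhds ht] with s hs using hmeas (continuousOn_heatKernel hα ε) s hs)
    (hbi.mono' (hmeas (continuousOn_heatKernel hα ε) t ht) (.of_forall fun p =>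
      hdom t ht _ p fun hg hf => (hC t ht p.1 hg p.2 hf).1))
    (hmeas (continuousOn_heatKernelDeriv hα ε) t ht)
    (.of_forall fun p s hs => hdom s hs _ p fun hg hf => (hC s hs p.1 hg p.2 hf).2)
    hbi
    (by
      filter_upwards [Measure.quasiMeasurePreserving_fst.ae (ae_mem_orthant α),
        Measure.quasiMeasurePreserving_snd.ae (ae_mem_orthant α)] with p h1 h2 s hs
      exact ((hasDerivAt_heatKernel hα ε hs h1 h2).ofReal_comp.mul_const _).mul_const _)).2
  have heq : (fun s => ∑' k, (Real.exp (-s * Λ k) : ℂ) * P k) =ᶠ[nhds t]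
      fun s => ∫ p, (heatKernel α ε s p.1 p.2 : ℂ) * f p.2 * (starRingEnd ℂ) (g p.1)
        ∂((wPlus α).prod (wPlus α)) := by
    filter_upwards [lt_mem_nhds ht] with s hs
    exact (hasSum_heatKernel_pairing hα ε hs f g).tsum_eq
  have huniq := (hder1.congr_of_eventuallyEq heq.symm).unique hder2
  have hsum : Summable fun k => ((-(Λ k * Real.exp (-t * Λ k)) : ℝ) : ℂ) * P k :=
    .of_norm_bounded (hPs.mul_left (2 / t)) fun k => hbd k t hts
  have h := hsum.hasSum
  rw [huniq] at h
  refine hasSum_of_eq h.neg (fun k => ?_) ?_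
  · simp only [hP, hΛ]
    push_cast
    ring
  · rw [← integral_neg]
    refine integral_congr_ae (.of_forall fun p => ?_)
    push_cast
    ring

/-- A pair of distinct points is covered by the off-diagonal bounds. -/
lemma heatKernel_bounds_of_ne {d : ℕ} {α : Fin d → ℝ} (hα : ∀ i, -1 / 2 ≤ α i)
    (ε : Fin d → Fin 2) {x y : Fin d → ℝ} (hx : x ∈ orthant d) (hy : y ∈ orthant d)
    (hxy : x ≠ y) :
    ∃ C : ℝ, ∀ t : ℝ, 0 < t →
      |heatKernel α ε t x y| ≤ C * Real.exp (-t * eigenvalue α 0) ∧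
      |heatKernelDeriv α ε t x y| ≤ C * Real.exp (-t * eigenvalue α 0) := by
  obtain ⟨i, hi⟩ := Function.ne_iff.1 hxy
  have hδ : 0 < ∑ i, (x i - y i) ^ 2 := Finset.sum_pos' (fun j _ => sq_nonneg _)
    ⟨i, Finset.mem_univ i, by have := sub_ne_zero.2 hi; positivity⟩
  obtain ⟨C, -, hC⟩ := heatKernel_bounds hα ε (le_max_of_le_left (norm_nonneg x) :
    0 ≤ max ‖x‖ ‖y‖) hδ
  exact ⟨C, fun t ht => hC t x y ht hx hy
    (fun i => (Real.le_norm_self _).trans ((norm_le_pi_norm x i).trans (le_max_left _ _)))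
    (fun i => (Real.le_norm_self _).trans ((norm_le_pi_norm y i).trans (le_max_right _ _)))
    le_rfl⟩

lemma continuousOn_time {d : ℕ} {H : ℝ × (Fin d → ℝ) × (Fin d → ℝ) → ℝ}
    (hH : ContinuousOn H (heatDomain d)) {x y : Fin d → ℝ} (hx : x ∈ orthant d)
    (hy : y ∈ orthant d) : ContinuousOn (fun t => H (t, x, y)) (Ioi 0) :=
  hH.comp (by fun_prop) fun _ ht => ⟨ht, hx, hy⟩

lemma integrableOn_exp_neg_mul {l : ℝ} (hl : 0 < l) :
    IntegrableOn (fun t => Real.exp (-t * l)) (Ioi 0) := by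
  refine (integrableOn_exp_mul_Ioi (neg_lt_zero.2 hl) 0).congr_fun (fun t _ => ?_)
    measurableSet_Ioi
  simp only
  congr 1
  ring

lemma integral_exp_neg_mul {l : ℝ} (hl : 0 < l) :
    ∫ t in Ioi (0 : ℝ), Real.exp (-t * l) = 1 / l := by
  have h := integral_exp_mul_Ioi (neg_lt_zero.2 hl) 0
  have e : ∀ t : ℝ, Real.exp (-t * l) = Real.exp (-l * t) := fun t => by congr 1; ring
  simp only [e, h]
  simp

/-- A measure that integrates a positive function is `σ`-finite. -/
lemma sigmaFinite_of_integrable_pos {X : Type*} [MeasurableSpace X] {ν : Measure X} {f : X → ℝ}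
    (hf : Integrable f ν) (hpos : ∀ x, 0 < f x) : SigmaFinite ν := by
  obtain ⟨t, ht, h0, hσ⟩ := hf.aefinStronglyMeasurable.exists_set_sigmaFinite
  have hν : ν.restrict t = ν := by
    refine Measure.restrict_eq_self_of_ae_mem ?_
    filter_upwards [(ae_restrict_iff' ht.compl).1 h0] with x hx
    by_contra hxt
    exact (hpos x).ne' (hx hxt)
  rwa [hν] at hσ

/-! ### Multipliers of Laplace and Laplace–Stieltjes type -/

/-- The time integral runs over `-∂_t G_t`, the kernel of `λ e^{-tλ}`, against `η dt`. -/
lemma laplaceMultiplier_isAssociatedWith {d : ℕ} (hd : 1 ≤ d) {α : Fin d → ℝ}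
    (hα : ∀ i, -1 / 2 ≤ α i) (ε : Fin d → Fin 2) {η : ℝ → ℂ} (hη : AEStronglyMeasurable η (volume.restrict (Ioi 0)))
    {C : ℝ} (hC : ∀ t : ℝ, 0 < t → ‖η t‖ ≤ C) :
    (∀ u : L2Plus α, Summable (multiplierTerm α hα ε (laplaceMultiplier η) u)) ∧
      (∀ x ∈ orthant d, ∀ y ∈ orthant d, x ≠ y →
        IntegrableOn (fun t => ((deriv (fun s => heatKernel α ε s x y) t : ℝ) : ℂ) * η t)
          (Ioi 0)) ∧
      IsAssociatedWith α hα (multiplierOp α hα ε (laplaceMultiplier η))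
        (laplaceKernel α ε η) := by
  have hC0 : 0 ≤ C := (norm_nonneg _).trans (hC 1 one_pos)
  have hev0 : 0 < eigenvalue α 0 :=
    lt_of_lt_of_le (by exact_mod_cast hd) (le_eigenvalue_zero hα)
  have hev : ∀ n, 0 < eigenvalue α n := fun n => hev0.trans_le (eigenvalue_zero_le α n)
  have hpos : ∀ᵐ t ∂(volume.restrict (Ioi (0 : ℝ))), 0 < t := ae_restrict_mem measurableSet_Ioi
  have hηbd : ∀ᵐ t ∂(volume.restrict (Ioi (0 : ℝ))), ‖η t‖ ≤ C := by
    filter_upwards [hpos] with t ht using hC t ht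
  have hm : ∀ n, laplaceMultiplier η (eigenvalue α n) = ∫ t in Ioi (0 : ℝ),
      ((eigenvalue α n * Real.exp (-t * eigenvalue α n) : ℝ) : ℂ) * η t := by
    intro n
    rw [laplaceMultiplier, ← integral_const_mul]
    refine integral_congr_ae (.of_forall fun t => ?_)
    push_cast
    ring
  have hexp : ∀ n, Integrable (fun t => eigenvalue α n * Real.exp (-t * eigenvalue α n))
      (volume.restrict (Ioi (0 : ℝ))) := fun n =>
    (integrableOn_exp_neg_mul (hev n)).const_mul _
  have ham : ∀ n, Integrable (fun t =>
      ((eigenvalue α n * Real.exp (-t * eigenvalue α n) : ℝ) : ℂ) * η t)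
      (volume.restrict (Ioi (0 : ℝ))) := fun n => (hexp n).ofReal.mul_bdd hη hηbd
  -- `∫_0^∞ λ e^{-tλ} dt = 1`, so that `m` is bounded by the bound of `η`
  have hM : ∀ n, ∫ t in Ioi (0 : ℝ),
      ‖((eigenvalue α n * Real.exp (-t * eigenvalue α n) : ℝ) : ℂ) * η t‖ ≤ C := by
    intro n
    calc _ ≤ ∫ t in Ioi (0 : ℝ), (eigenvalue α n * Real.exp (-t * eigenvalue α n)) * C := by
          refine integral_mono_ae (ham n).norm ((hexp n).mul_const C) ?_
          filter_upwards [hηbd] with t ht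
          rw [norm_mul, Complex.norm_real,
            Real.norm_of_nonneg (mul_pos (hev n) (Real.exp_pos _)).le]
          have := (hev n).le
          gcongr
      _ = C := by
          rw [integral_mul_const, integral_const_mul, integral_exp_neg_mul (hev n)]
          have := (hev n).ne'
          field_simp
  have hderiv : ∀ x ∈ orthant d, ∀ y ∈ orthant d, ∀ t ∈ Ioi (0 : ℝ),
      deriv (fun s => heatKernel α ε s x y) t = heatKernelDeriv α ε t x y :=
    fun x hx y hy t ht => (hasDerivAt_heatKernel hα ε ht hx hy).deriv
  refine ⟨summable_multiplierTerm hα ε (M := C) fun n => ?_, fun x hx y hy hxy => ?_, ?_⟩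
  · rw [hm]
    exact (norm_integral_le_integral_norm _).trans (hM n)
  · obtain ⟨C', hC'⟩ := heatKernel_bounds_of_ne hα ε hx hy hxy
    have h1 : Integrable (fun t => heatKernelDeriv α ε t x y) (volume.restrict (Ioi 0)) := by
      refine ((integrableOn_exp_neg_mul hev0).const_mul C').mono' ?_ ?_
      · exact (continuousOn_time (continuousOn_heatKernelDeriv hα ε) hx hy).aestronglyMeasurable
          measurableSet_Ioi
      · filter_upwards [hpos] with t ht using (hC' t ht).2
    have h2 : IntegrableOn (fun t => (heatKernelDeriv α ε t x y : ℂ) * η t) (Ioi 0) :=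
      h1.ofReal.mul_bdd hη hηbd
    exact h2.congr_fun (fun t ht => by simp only [hderiv x hx y hy t ht]) measurableSet_Ioi
  · refine isAssociatedWith_of_integral hα ε hpos hη
      (H := fun t x y => -heatKernelDeriv α ε t x y)
      (B := fun t => Real.exp (-t * eigenvalue α 0))
      (a := fun l t => l * Real.exp (-t * l))
      (continuousOn_heatKernelDeriv hα ε).neg
      ((integrableOn_exp_neg_mul hev0).mul_bdd hη.norm (hηbd.mono fun t ht => by rwa [norm_norm]))
      (fun f g hfg => ?_) (fun f g hfg t ht => hasSum_heatKernelDeriv_pairing hα ε hfg ht)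
      hm ham hM fun x hx y hy => ?_
    · obtain ⟨C', -, hC'⟩ := heatKernel_bounds_tsupport hα ε hfg
      exact ⟨C', fun t ht x hx y hy => by rw [abs_neg]; exact (hC' t ht x hx y hy).2⟩
    · rw [laplaceKernel, ← integral_neg]
      refine setIntegral_congr_fun measurableSet_Ioi fun t ht => ?_
      simp only [hderiv x hx y hy t ht]
      push_cast
      ring

/-- The time integral runs over `G_t`, the kernel of `e^{-tλ}`, against `dμ`. -/
lemma stieltjesMultiplier_isAssociatedWith {d : ℕ} {α : Fin d → ℝ} (hα : ∀ i, -1 / 2 ≤ α i)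
    (ε : Fin d → Fin 2) {μ : PolarMeasure}
    (hμ : IntegrableOn (fun t => Real.exp (-t * eigenvalue α 0)) (Ioi 0) μ.variation) :
    (∀ u : L2Plus α, Summable (multiplierTerm α hα ε (stieltjesMultiplier μ) u)) ∧
      (∀ x ∈ orthant d, ∀ y ∈ orthant d, x ≠ y →
        IntegrableOn (fun t => heatKernel α ε t x y) (Ioi 0) μ.variation) ∧
      IsAssociatedWith α hα (multiplierOp α hα ε (stieltjesMultiplier μ))
        (stieltjesKernel α ε μ) := by
  set ν := μ.variation.restrict (Ioi 0) with hν
  have : SigmaFinite ν := sigmaFinite_of_integrable_pos hμ fun t => Real.exp_pos _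
  have hpos : ∀ᵐ t ∂ν, 0 < t := ae_restrict_mem measurableSet_Ioi
  have hφ : AEStronglyMeasurable μ.phase ν := μ.measurable_phase.aestronglyMeasurable
  have hφbd : ∀ᵐ t ∂ν, ‖μ.phase t‖ ≤ 1 := by
    filter_upwards [hpos] with t ht using (μ.norm_phase t ht).le
  have hexp : ∀ n, Integrable (fun t => Real.exp (-t * eigenvalue α n)) ν := by
    intro n
    refine hμ.mono' (by fun_prop) ?_
    filter_upwards [hpos] with t ht
    rw [Real.norm_of_nonneg (Real.exp_pos _).le]
    exact Real.exp_le_exp.2 (by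
      nlinarith [mul_le_mul_of_nonneg_left (eigenvalue_zero_le α n) ht.le])
  have ham : ∀ n, Integrable (fun t =>
      ((Real.exp (-t * eigenvalue α n) : ℝ) : ℂ) * μ.phase t) ν := fun n =>
    (hexp n).ofReal.mul_bdd hφ hφbd
  have hM : ∀ n, ∫ t, ‖((Real.exp (-t * eigenvalue α n) : ℝ) : ℂ) * μ.phase t‖ ∂ν ≤
      ∫ t, Real.exp (-t * eigenvalue α 0) ∂ν := by
    intro n
    refine integral_mono_ae (ham n).norm hμ ?_
    filter_upwards [hpos] with t ht
    rw [norm_mul, μ.norm_phase t ht, mul_one, Complex.norm_real,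
      Real.norm_of_nonneg (Real.exp_pos _).le]
    exact Real.exp_le_exp.2 (by
      nlinarith [mul_le_mul_of_nonneg_left (eigenvalue_zero_le α n) ht.le])
  refine ⟨summable_multiplierTerm hα ε fun n => (norm_integral_le_integral_norm _).trans (hM n),
    fun x hx y hy hxy => ?_, ?_⟩
  · obtain ⟨C, hC⟩ := heatKernel_bounds_of_ne hα ε hx hy hxy
    refine (hμ.const_mul C).mono' ?_ ?_
    · exact (continuousOn_time (continuousOn_heatKernel hα ε) hx hy).aestronglyMeasurable
        measurableSet_Ioi
    · filter_upwards [hpos] with t ht using (hC t ht).1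
  · refine isAssociatedWith_of_integral hα ε hpos hφ
      (H := heatKernel α ε) (B := fun t => Real.exp (-t * eigenvalue α 0))
      (a := fun l t => Real.exp (-t * l)) (continuousOn_heatKernel hα ε)
      (hμ.mul_bdd (c := 1) hφ.norm (hφbd.mono fun t ht => by rwa [norm_norm]))
      (fun f g hfg => ?_) (fun f g _ t ht => hasSum_heatKernel_pairing hα ε ht f g)
      (fun n => rfl) ham hM fun x hx y hy => rfl
    obtain ⟨C, -, hC⟩ := heatKernel_bounds_tsupport hα ε hfg
    exact ⟨C, fun t ht x hx y hy => (hC t ht x hx y hy).1⟩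

end Dunkl

theorem proposition2p4 {d : ℕ} (hd : 1 ≤ d) (α : Fin d → ℝ) (hα : ∀ i, -1 / 2 ≤ α i)
    (ε : Fin d → Fin 2) :
    (∀ η : ℝ → ℂ, AEStronglyMeasurable η (volume.restrict (Ioi 0)) →
      (∃ C : ℝ, ∀ t : ℝ, 0 < t → ‖η t‖ ≤ C) →
      (∀ u : Dunkl.L2Plus α,
        Summable (Dunkl.multiplierTerm α hα ε (Dunkl.laplaceMultiplier η) u)) ∧
      (∀ x ∈ Dunkl.orthant d, ∀ y ∈ Dunkl.orthant d, x ≠ y →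
        IntegrableOn (fun t =>
          ((deriv (fun s => Dunkl.heatKernel α ε s x y) t : ℝ) : ℂ) * η t)
          (Ioi 0)) ∧
      Dunkl.IsAssociatedWith α hα
        (Dunkl.multiplierOp α hα ε (Dunkl.laplaceMultiplier η))
        (Dunkl.laplaceKernel α ε η)) ∧
    (∀ μ : Dunkl.PolarMeasure,
      IntegrableOn (fun t => Real.exp (-t * Dunkl.eigenvalue α 0)) (Ioi 0) μ.variation →
      (∀ u : Dunkl.L2Plus α,
        Summable (Dunkl.multiplierTerm α hα ε (Dunkl.stieltjesMultiplier μ) u)) ∧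
      (∀ x ∈ Dunkl.orthant d, ∀ y ∈ Dunkl.orthant d, x ≠ y →
        IntegrableOn (fun t => Dunkl.heatKernel α ε t x y) (Ioi 0) μ.variation) ∧
      Dunkl.IsAssociatedWith α hα
        (Dunkl.multiplierOp α hα ε (Dunkl.stieltjesMultiplier μ))
        (Dunkl.stieltjesKernel α ε μ)) :=
  ⟨fun _ hη ⟨_, hC⟩ => Dunkl.laplaceMultiplier_isAssociatedWith hd hα ε hη hC,
    fun _ hμ => Dunkl.stieltjesMultiplier_isAssociatedWith hα ε hμ⟩
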